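/- Let $n\ge 2$ and let $X_1,\dots,X_n$ be independent random variables, $X_j$ having the gamma density $\Gamma(\alpha_j)^{-1}e^{-t}t^{\alpha_j-1}$ $(t>0)$ with order $\alpha_j>0$. Put $\alpha=\alpha_1+\dots+\alpha_n$ and $$U_n^2=\Bigl(\sum_{i=1}^n X_i\Bigr)^{-2}\sum_{i=1}^n X_i^2 .$$ For real $\nu$ let $D_\nu$ denote Whittaker's parabolic cylinder function, i.e. the entire function $$D_\nu(z)=2^{\nu/2}e^{-z^2/4}\left(\frac{\sqrt{\pi}}{\Gamma\left(\frac{1-\nu}{2}\right)}\,M\left(-\tfrac{\nu}{2},\tfrac12,\tfrac{z^2}{2}\right)-\frac{\sqrt{2\pi}\,z}{\Gamma\left(-\frac{\nu}{2}\right)}\,M\left(\tfrac{1-\nu}{2},\tfrac32,\tfrac{z^2}{2}\right)\right),\qquad M(a,b,z)=\sum_{k=0}^\infty\frac{(a)_k}{(b)_k}\frac{z^k}{k!},$$ with $(c)_k=\prod_{i=0}^{k-1}(c+i)$ and $1/\Gamma=0$ at the poles of $\Gamma$, and let $\sqrt{i}=e^{i\pi/4}$, $\sqrt{-i}=e^{-i\pi/4}$.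 If $\alpha>1$, then for every $x>0$ $$P\{U_n^2\le x\}=\pi^{-3/2}\sqrt2\,\Gamma(\alpha)\,x^{(\alpha-1)/2}\int_0^\infty \Re\left(\left(\prod_{j=1}^n e^{-is^2/4}D_{-\alpha_j}\left(i\sqrt{i}\,s\right)\right)e^{is^2/(4x)}\,D_{-\alpha}\left(\sqrt{-i}\,s\,x^{-1/2}\right)\sqrt{i}\right)ds ,$$ where the expression inside $\Re(\cdot)$ is absolutely integrable over $s\in(0,\infty)$. -/

import Mathlib

open MeasureTheory ProbabilityTheory
open scoped Nat

noncomputable section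

/-- Kummer's confluent hypergeometric series
`M(a, b, z) = ∑ₖ (a)ₖ / (b)ₖ * z ^ k / k!`, for `b` not a non-positive integer. -/
def kummerM (a b : ℝ) (z : ℂ) : ℂ :=
  ∑' k : ℕ,
    (((ascPochhammer ℝ k).eval a / ((ascPochhammer ℝ k).eval b * (k ! : ℝ)) : ℝ) : ℂ) * z ^ k

/-- Whittaker's parabolic cylinder function `D_ν(z)` of real order `ν` and complex argument `z`,
i.e. the combination of the even and the odd standard solution of
`w'' = (z ^ 2 / 4 - ν - 1 / 2) w` with `D_ν(0) = 2 ^ (ν / 2) √π / Γ((1 - ν) / 2)` and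
`D_ν'(0) = - 2 ^ ((ν + 1) / 2) √π / Γ(-ν / 2)`.
It is an entire function of `z`. The reciprocal `1 / Γ` is `0` at the poles of `Γ`, which is
also the value of `(Real.Gamma x)⁻¹` there. -/
def parabolicCylinderD (ν : ℝ) (z : ℂ) : ℂ :=
  (((2 : ℝ) ^ (ν / 2) : ℝ) : ℂ) * Complex.exp (-z ^ 2 / 4) *
    (((√Real.pi * (Real.Gamma ((1 - ν) / 2))⁻¹ : ℝ) : ℂ) *
        kummerM (-ν / 2) (1 / 2) (z ^ 2 / 2) -
      ((√(2 * Real.pi) * (Real.Gamma (-ν / 2))⁻¹ : ℝ) : ℂ) * z *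
        kummerM ((1 - ν) / 2) (3 / 2) (z ^ 2 / 2))

/-- The principal square root of a complex number: `principalSqrt I = exp (π I / 4)`,
`principalSqrt (-I) = exp (-π I / 4)`. -/
def principalSqrt (z : ℂ) : ℂ := z ^ (1 / 2 : ℂ)

/-- For orders `a 1, …, a n` and `x > 0`, with `A = a 1 + ⋯ + a n`, the complex-valued function
`s ↦ (∏ⱼ exp (-i s² / 4) D_{-a j}(i √i s)) · exp (i s² / (4 x)) · D_{-A}(√(-i) s x^{-1/2}) · √i`. -/
def cylinderIntegrand {n : ℕ} (a : Fin n → ℝ) (x s : ℝ) : ℂ :=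
  (∏ j, Complex.exp (-(Complex.I * (s : ℂ) ^ 2) / 4) *
      parabolicCylinderD (-a j) (Complex.I * principalSqrt Complex.I * (s : ℂ))) *
    Complex.exp (Complex.I * (s : ℂ) ^ 2 / (4 * (x : ℂ))) *
    parabolicCylinderD (-∑ j, a j)
      (principalSqrt (-Complex.I) * (s : ℂ) * ((x ^ (-(1 / 2) : ℝ) : ℝ) : ℂ)) *
    principalSqrt Complex.I

end

/-! Write I_a(z) = Γ(a) exp(z²/4) D_{-a}(z) = ∫₀^∞ t^(a-1) exp(-t²/2 - zt) dt, ζ = exp(-iπ/4), κ =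
x^(-1/2), α = ∑ a_j and L_α(w) = exp(-w²/2) I_α(w). The exponential factors of the integrand are
such that it equals ζ⁻¹ ∏ I_{a_j}(-ζs)/Γ(a_j) · L_α(κζs)/Γ(α) (`cylinderIntegrand_eq`).

Probability enters through I_a(z)/Γ(a) = E exp(-X²/2 - (z-1)X) for X gamma of order a. The sum of
independent gamma variables is gamma of order α and independent of the direction. Hence, with V =
U_n², the product of the I_{a_j}(z)/Γ(a_j) is the mixture E[V^(-α/2) I_α(z/√V)]/Γ(α)
(`prod_cylinderIntegral_eq`). After Fubini and rescaling, only the transform Φ(r) = ∫ I_α(-ζs)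
r^(1-α) L_α(rζs) ds at r = κ√V matters, and Re(ζ⁻¹Φ(r)) should be a constant times the indicator of
r < 1, that is, of V < x.

The integral Φ need not converge absolutely, so the kernel is rotated to the direction
exp(i(δ-π/4)), where it decays like a Gaussian. A Lagrange identity between the two differential
equations gives Φ'(r) in closed form, with denominator 1 - r exp(iδ) (`hasDerivAt_rayTransform`).
Since Φ(∞) = 0 for α > 1, Re(ζ⁻¹Φ(r)) is the integral of u^(1-α) over u > r against a Cauchy density
concentrating at u = 1 as δ → 0 (`tendsto_re_rayTransform`).

On the other side δ → 0 is taken under the s-integral of the full product. The majorant comes from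
an energy estimate (`exists_sq_add_sq_le`): the product is O(s^(α-β)) with β = ∑ min(1, 2a_j) > 1,
and the kernel is O(s^(-α)) uniformly in δ. `re_integral_rayProduct_mul_kernel` equates the two
limits. -/

/-! ### The integral representation of D_{-a} and its agreement with the Kummer series. -/

section CylinderIntegral

open Set Filter Topology

/-- The integral `∫₀^∞ t ^ (a - 1) exp (-t² / 2 - z t) dt`, which represents
`Γ(a) exp (z² / 4) D_{-a}(z)`. -/
noncomputable def cylinderIntegral (a : ℝ) (z : ℂ) : ℂ :=
  ∫ t in Ioi (0 : ℝ), ((t ^ (a - 1) : ℝ) : ℂ) * Complex.exp (-(t : ℂ) ^ 2 / 2 - z * t)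

lemma integrableOn_rpow_mul_exp_quadratic {a : ℝ} (ha : 0 < a) (c : ℝ) :
    IntegrableOn (fun t : ℝ => t ^ (a - 1) * Real.exp (-t ^ 2 / 2 + c * t)) (Ioi 0) := by
  refine Integrable.mono' (((integrableOn_rpow_mul_exp_neg_mul_sq (b := 1 / 4) (by norm_num)
    (s := a - 1) (by linarith))).const_mul (Real.exp (c ^ 2))) (by fun_prop) ?_
  filter_upwards [ae_restrict_mem measurableSet_Ioi] with t ht
  have ht : 0 < t := ht
  rw [Real.norm_of_nonneg (by positivity), mul_left_comm, ← Real.exp_add]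
  refine mul_le_mul_of_nonneg_left (Real.exp_le_exp.2 ?_) (by positivity)
  nlinarith [sq_nonneg (t / 2 - c)]

lemma norm_cylinderIntegral_integrand {a : ℝ} (z : ℂ) {t : ℝ} (ht : 0 < t) :
    ‖((t ^ (a - 1) : ℝ) : ℂ) * Complex.exp (-(t : ℂ) ^ 2 / 2 - z * t)‖ =
      t ^ (a - 1) * Real.exp (-t ^ 2 / 2 + -z.re * t) := by
  rw [norm_mul, Complex.norm_real, Real.norm_of_nonneg (by positivity), Complex.norm_exp]
  congr 2
  have : (-(t : ℂ) ^ 2 / 2) = ((-t ^ 2 / 2 : ℝ) : ℂ) := by push_cast; ring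
  rw [this, Complex.sub_re, Complex.ofReal_re, Complex.re_mul_ofReal]
  ring

lemma measurable_cylinderIntegral_integrand (a : ℝ) (z : ℂ) :
    Measurable fun t : ℝ =>
      ((t ^ (a - 1) : ℝ) : ℂ) * Complex.exp (-(t : ℂ) ^ 2 / 2 - z * t) := by
  fun_prop

lemma integrableOn_cylinderIntegral {a : ℝ} (ha : 0 < a) (z : ℂ) :
    IntegrableOn (fun t : ℝ =>
      ((t ^ (a - 1) : ℝ) : ℂ) * Complex.exp (-(t : ℂ) ^ 2 / 2 - z * t)) (Ioi 0) := by
  refine (integrableOn_rpow_mul_exp_quadratic ha (-z.re)).mono'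
    (measurable_cylinderIntegral_integrand a z).aestronglyMeasurable ?_
  filter_upwards [ae_restrict_mem measurableSet_Ioi] with t ht
  rw [norm_cylinderIntegral_integrand z ht]

lemma hasDerivAt_cylinderIntegral {a : ℝ} (ha : 0 < a) (z : ℂ) :
    HasDerivAt (cylinderIntegral a) (-cylinderIntegral (a + 1) z) z := by
  have key := hasDerivAt_integral_of_dominated_loc_of_deriv_le (𝕜 := ℂ)
    (μ := volume.restrict (Ioi (0 : ℝ)))
    (F := fun z t => ((t ^ (a - 1) : ℝ) : ℂ) * Complex.exp (-(t : ℂ) ^ 2 / 2 - z * t))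
    (F' := fun z t => -(((t ^ (a + 1 - 1) : ℝ) : ℂ) * Complex.exp (-(t : ℂ) ^ 2 / 2 - z * t)))
    (bound := fun t => t ^ (a + 1 - 1) * Real.exp (-t ^ 2 / 2 + (-z.re + 1) * t))
    (x₀ := z) (s := Metric.ball z 1) (Metric.ball_mem_nhds z one_pos)
    (Eventually.of_forall fun w =>
      (measurable_cylinderIntegral_integrand a w).aestronglyMeasurable)
    (integrableOn_cylinderIntegral ha z)
    (measurable_cylinderIntegral_integrand (a + 1) z).neg.aestronglyMeasurable
    ?_ (integrableOn_rpow_mul_exp_quadratic (by linarith) _) ?_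
  · have := key.2
    rw [integral_neg] at this
    exact this
  · filter_upwards [ae_restrict_mem measurableSet_Ioi] with t ht w hw
    have ht : 0 < t := ht
    rw [norm_neg, norm_cylinderIntegral_integrand w ht]
    gcongr
    have h1 : |(w - z).re| ≤ ‖w - z‖ := Complex.abs_re_le_norm _
    have h2 : ‖w - z‖ < 1 := by simpa [dist_eq_norm] using hw
    have := (abs_le.1 (h1.trans h2.le)).1
    rw [Complex.sub_re] at this
    linarith
  · filter_upwards [ae_restrict_mem measurableSet_Ioi] with t ht w hw
    have ht : 0 < t := ht
    have h : HasDerivAt (fun w : ℂ => -(t : ℂ) ^ 2 / 2 - w * t) (-(1 * (t : ℂ))) w :=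
      ((hasDerivAt_id w).mul_const (t : ℂ)).const_sub _
    have h2 := h.cexp.const_mul ((t ^ (a - 1) : ℝ) : ℂ)
    refine h2.congr_deriv ?_
    have : t ^ (a + 1 - 1) = t ^ (a - 1) * t := by
      rw [← Real.rpow_add_one ht.ne']; ring_nf
    rw [this]
    push_cast
    ring

lemma differentiable_cylinderIntegral {a : ℝ} (ha : 0 < a) :
    Differentiable ℂ (cylinderIntegral a) :=
  fun z => (hasDerivAt_cylinderIntegral ha z).differentiableAt

lemma continuous_cylinderIntegral {a : ℝ} (ha : 0 < a) : Continuous (cylinderIntegral a) :=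
  (differentiable_cylinderIntegral ha).continuous

/-- Integrate the derivative of t^a exp(-t²/2 - zt) over the half-line; both boundary terms vanish
because a > 0. Together with I_a' = -I_{a+1} this is the parabolic cylinder equation, and every
later differential identity is reduced to it. -/
lemma cylinderIntegral_add_two {a : ℝ} (ha : 0 < a) (z : ℂ) :
    cylinderIntegral (a + 2) z = a * cylinderIntegral a z - z * cylinderIntegral (a + 1) z := by
  let F : ℝ → ℂ := fun t => ((t ^ a : ℝ) : ℂ) * Complex.exp (-(t : ℂ) ^ 2 / 2 - z * t)
  let F' : ℝ → ℂ := fun t =>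
    a * (((t ^ (a - 1) : ℝ) : ℂ) * Complex.exp (-(t : ℂ) ^ 2 / 2 - z * t))
    - z * (((t ^ (a + 1 - 1) : ℝ) : ℂ) * Complex.exp (-(t : ℂ) ^ 2 / 2 - z * t))
    - ((t ^ (a + 2 - 1) : ℝ) : ℂ) * Complex.exp (-(t : ℂ) ^ 2 / 2 - z * t)
  have i0 := (integrableOn_cylinderIntegral ha z).const_mul (a : ℂ)
  have i1 := (integrableOn_cylinderIntegral (show 0 < a + 1 by linarith) z).const_mul z
  have i2 := integrableOn_cylinderIntegral (show 0 < a + 2 by linarith) z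
  have hderiv : ∀ t ∈ Ioi (0 : ℝ), HasDerivAt F (F' t) t := by
    intro t ht
    have ht : 0 < t := ht
    have h1 : HasDerivAt (fun t : ℝ => ((t ^ a : ℝ) : ℂ)) ((a * t ^ (a - 1) : ℝ) : ℂ) t :=
      (Real.hasDerivAt_rpow_const (Or.inl ht.ne')).ofReal_comp
    have h2 : HasDerivAt (fun t : ℝ => -(t : ℂ) ^ 2 / 2 - z * t) (-(t : ℂ) - z) t := by
      have h3 : HasDerivAt (fun t : ℂ => -t ^ 2 / 2 - z * t) (-(t : ℂ) - z) (t : ℂ) := by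
        have := ((((hasDerivAt_id (t : ℂ)).pow 2).neg).div_const 2).sub
          ((hasDerivAt_id (t : ℂ)).const_mul z)
        refine this.congr_deriv ?_
        simp
        ring
      exact h3.comp_ofReal
    refine (h1.mul h2.cexp).congr_deriv ?_
    have e1 : t ^ (a + 1 - 1) = t ^ (a - 1) * t := by
      rw [← Real.rpow_add_one ht.ne']; ring_nf
    have e2 : t ^ (a + 2 - 1) = t ^ (a - 1) * t * t := by
      rw [← Real.rpow_add_one ht.ne', ← Real.rpow_add_one ht.ne']; ring_nf
    have e3 : t ^ a = t ^ (a - 1) * t := by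
      rw [← Real.rpow_add_one ht.ne']; ring_nf
    simp only [F', e1, e2, e3]
    push_cast
    ring
  have hF'int : IntegrableOn F' (Ioi 0) := (i0.sub i1).sub i2
  have hFint : IntegrableOn F (Ioi 0) := by
    have := integrableOn_cylinderIntegral (show 0 < a + 1 by linarith) z
    simpa only [add_sub_cancel_right] using this
  have hlim := tendsto_zero_of_hasDerivAt_of_integrableOn_Ioi hderiv hF'int hFint
  have hcont : ContinuousWithinAt F (Ici 0) 0 := by
    have h1 : Continuous fun t : ℝ => t ^ a := Real.continuous_rpow_const ha.le
    have : Continuous F := by fun_prop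
    exact this.continuousWithinAt
  have hI := integral_Ioi_of_hasDerivAt_of_tendsto hcont hderiv hF'int hlim
  have hF0 : F 0 = 0 := by simp [F, Real.zero_rpow ha.ne']
  have hsplit : ∫ t in Ioi (0 : ℝ), F' t = a * cylinderIntegral a z
      - z * cylinderIntegral (a + 1) z - cylinderIntegral (a + 2) z := by
    simp only [F', cylinderIntegral]
    rw [← integral_const_mul, ← integral_const_mul, ← integral_sub i0 i1]
    exact integral_sub (i0.sub i1) i2
  rw [hsplit, hF0, sub_zero] at hI
  linear_combination -hI

lemma cylinderIntegral_ofReal (a : ℝ) (c : ℝ) :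
    cylinderIntegral a c =
      ((∫ t in Ioi (0 : ℝ), t ^ (a - 1) * Real.exp (-t ^ 2 / 2 - c * t) : ℝ) : ℂ) := by
  rw [cylinderIntegral, ← integral_complex_ofReal]
  congr 1
  ext t
  push_cast
  ring_nf

lemma norm_cylinderIntegral_le {a : ℝ} (ha : 0 < a) {z : ℂ} (hz : 0 ≤ z.re) :
    ‖cylinderIntegral a z‖ ≤ ‖cylinderIntegral a 0‖ := by
  have h0 := cylinderIntegral_ofReal a 0
  have i0 := integrableOn_rpow_mul_exp_quadratic ha 0
  rw [Complex.ofReal_zero] at h0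
  rw [h0, Complex.norm_real]
  refine le_trans ?_ (le_abs_self _)
  refine norm_integral_le_of_norm_le (by simpa [IntegrableOn] using i0) ?_
  filter_upwards [ae_restrict_mem measurableSet_Ioi] with t ht
  have ht : 0 < t := ht
  rw [norm_cylinderIntegral_integrand z ht]
  gcongr
  nlinarith

/-- Dropping the Gaussian factor leaves a gamma integral. This is the source of the decay s^(-α) of
the kernel. -/
lemma norm_cylinderIntegral_le_rpow {a : ℝ} (ha : 0 < a) {z : ℂ} (hz : 0 < z.re) :
    ‖cylinderIntegral a z‖ ≤ Real.Gamma a * z.re ^ (-a) := by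
  have h := Real.integral_rpow_mul_exp_neg_mul_Ioi ha hz
  have i0 : IntegrableOn (fun t : ℝ => t ^ (a - 1) * Real.exp (-(z.re * t))) (Ioi 0) := by
    have := integrableOn_rpow_mul_exp_neg_mul_rpow (s := a - 1) (p := 1) (b := z.re)
      (by linarith) one_pos hz
    simpa using this
  rw [Real.rpow_neg hz.le, mul_comm, ← Real.inv_rpow hz.le, ← one_div, ← h]
  refine norm_integral_le_of_norm_le i0 ?_
  filter_upwards [ae_restrict_mem measurableSet_Ioi] with t ht
  have ht : 0 < t := ht
  rw [norm_cylinderIntegral_integrand z ht]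
  gcongr
  nlinarith

lemma cylinderIntegral_zero {a : ℝ} (ha : 0 < a) :
    cylinderIntegral a 0 = ((2 ^ (a / 2 - 1) * Real.Gamma (a / 2) : ℝ) : ℂ) := by
  have h0 := cylinderIntegral_ofReal a 0
  rw [Complex.ofReal_zero] at h0
  rw [h0]
  congr 1
  have h := integral_rpow_mul_exp_neg_mul_rpow (p := 2) (q := a - 1) (b := 1 / 2) two_pos
    (by linarith) (by norm_num)
  have e : (1 / 2 : ℝ) ^ (-(a - 1 + 1) / 2) * (1 / 2) = 2 ^ (a / 2 - 1) := by
    rw [one_div, Real.inv_rpow (by norm_num), ← Real.rpow_neg (by norm_num),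
      Real.rpow_sub (by norm_num), Real.rpow_one]
    ring_nf
  rw [e] at h
  rw [show a / 2 = (a - 1 + 1) / 2 by ring] at *
  rw [show (a - 1 + 1) / 2 = a / 2 by ring] at *
  rw [← h]
  refine setIntegral_congr_fun measurableSet_Ioi fun t _ => ?_
  simp only [Real.rpow_two]
  ring_nf

lemma iteratedDeriv_cylinderIntegral {a : ℝ} (ha : 0 < a) (k : ℕ) :
    iteratedDeriv k (cylinderIntegral a) = fun z => (-1) ^ k * cylinderIntegral (a + k) z := by
  induction k with
  | zero => ext z; simp
  | succ k ih =>
    rw [iteratedDeriv_succ, ih]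
    ext z
    have := (hasDerivAt_cylinderIntegral (show 0 < a + k by positivity) z).const_mul ((-1 : ℂ) ^ k)
    rw [this.deriv]
    push_cast
    rw [add_assoc]
    ring

lemma hasSum_cylinderIntegral {a : ℝ} (ha : 0 < a) (z : ℂ) :
    HasSum (fun k : ℕ => (k ! : ℂ)⁻¹ * z ^ k * ((-1) ^ k * cylinderIntegral (a + k) 0))
      (cylinderIntegral a z) := by
  have := Complex.hasSum_taylorSeries_of_entire (differentiable_cylinderIntegral ha) 0 z
  simpa [iteratedDeriv_cylinderIntegral ha, mul_assoc] using this

/-- At z = 0 the recurrence reads I_{a+2}(0) = a I_a(0). Iterating it produces the Pochhammer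
symbols in the numerators of the Kummer series. -/
lemma cylinderIntegral_add_two_mul_zero {a : ℝ} (ha : 0 < a) (m : ℕ) :
    cylinderIntegral (a + (2 * m : ℕ)) 0 =
      2 ^ m * (((ascPochhammer ℝ m).eval (a / 2) : ℝ) : ℂ) * cylinderIntegral a 0 := by
  induction m with
  | zero => simp
  | succ m ih =>
    have h := cylinderIntegral_add_two (show 0 < a + (2 * m : ℕ) by positivity) 0
    rw [zero_mul, sub_zero, ih] at h
    rw [show a + ((2 * (m + 1) : ℕ) : ℝ) = a + (2 * m : ℕ) + 2 by push_cast; ring, h,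
      ascPochhammer_succ_right]
    simp
    ring

lemma factorial_two_mul_eq_ascPochhammer (m : ℕ) :
    ((2 * m)! : ℝ) = 4 ^ m * (ascPochhammer ℝ m).eval (1 / 2) * m ! := by
  induction m with
  | zero => simp
  | succ m ih =>
    rw [show 2 * (m + 1) = 2 * m + 1 + 1 by ring, Nat.factorial_succ, Nat.factorial_succ,
      Nat.factorial_succ]
    push_cast
    rw [ih, ascPochhammer_succ_right]
    simp
    ring

lemma factorial_two_mul_add_one_eq_ascPochhammer (m : ℕ) :
    ((2 * m + 1)! : ℝ) = 4 ^ m * (ascPochhammer ℝ m).eval (3 / 2) * m ! := by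
  induction m with
  | zero => simp
  | succ m ih =>
    rw [show 2 * (m + 1) + 1 = 2 * m + 1 + 1 + 1 by ring, Nat.factorial_succ, Nat.factorial_succ,
      Nat.factorial_succ m]
    push_cast
    rw [ih, ascPochhammer_succ_right]
    simp
    ring

lemma ascPochhammer_eval_ne_zero {c : ℝ} (hc : 0 < c) (m : ℕ) : (ascPochhammer ℝ m).eval c ≠ 0 :=
  (ascPochhammer_pos m c hc).ne'

lemma taylor_term_even {a : ℝ} (ha : 0 < a) (z : ℂ) (m : ℕ) :
    ((2 * m)! : ℂ)⁻¹ * z ^ (2 * m) * ((-1) ^ (2 * m) * cylinderIntegral (a + (2 * m : ℕ)) 0) =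
      cylinderIntegral a 0 * ((((ascPochhammer ℝ m).eval (a / 2) /
        ((ascPochhammer ℝ m).eval (1 / 2) * (m ! : ℝ)) : ℝ) : ℂ) * (z ^ 2 / 2) ^ m) := by
  have h4 : (4 : ℂ) ^ m = 2 ^ m * 2 ^ m := by rw [← mul_pow]; norm_num
  have hm : (m ! : ℂ) ≠ 0 := Nat.cast_ne_zero.2 m.factorial_ne_zero
  have h2 : ((2 * m)! : ℂ) =
      4 ^ m * (((ascPochhammer ℝ m).eval (1 / 2) : ℝ) : ℂ) * (m ! : ℂ) := by
    rw [← Complex.ofReal_natCast, factorial_two_mul_eq_ascPochhammer m]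
    push_cast
    rfl
  have h3 : (((ascPochhammer ℝ m).eval (1 / 2) : ℝ) : ℂ) ≠ 0 :=
    Complex.ofReal_ne_zero.2 (ascPochhammer_eval_ne_zero (by norm_num) m)
  rw [cylinderIntegral_add_two_mul_zero ha, h2, Complex.ofReal_div, Complex.ofReal_mul,
    Complex.ofReal_natCast]
  generalize (((ascPochhammer ℝ m).eval (1 / 2) : ℝ) : ℂ) = p at h3 ⊢
  generalize (((ascPochhammer ℝ m).eval (a / 2) : ℝ) : ℂ) = q
  generalize (m ! : ℂ) = l at hm ⊢
  rw [div_pow, pow_mul, pow_mul, h4, neg_one_sq, one_pow]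
  field_simp

lemma taylor_term_odd {a : ℝ} (ha : 0 < a) (z : ℂ) (m : ℕ) :
    ((2 * m + 1)! : ℂ)⁻¹ * z ^ (2 * m + 1) *
        ((-1) ^ (2 * m + 1) * cylinderIntegral (a + (2 * m + 1 : ℕ)) 0) =
      -(z * cylinderIntegral (a + 1) 0 * ((((ascPochhammer ℝ m).eval ((1 + a) / 2) /
        ((ascPochhammer ℝ m).eval (3 / 2) * (m ! : ℝ)) : ℝ) : ℂ) * (z ^ 2 / 2) ^ m)) := by
  have h4 : (4 : ℂ) ^ m = 2 ^ m * 2 ^ m := by rw [← mul_pow]; norm_num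
  have hm : (m ! : ℂ) ≠ 0 := Nat.cast_ne_zero.2 m.factorial_ne_zero
  have h2 : ((2 * m + 1)! : ℂ) =
      4 ^ m * (((ascPochhammer ℝ m).eval (3 / 2) : ℝ) : ℂ) * (m ! : ℂ) := by
    rw [← Complex.ofReal_natCast, factorial_two_mul_add_one_eq_ascPochhammer m]
    push_cast
    rfl
  have h3 : (((ascPochhammer ℝ m).eval (3 / 2) : ℝ) : ℂ) ≠ 0 :=
    Complex.ofReal_ne_zero.2 (ascPochhammer_eval_ne_zero (by norm_num) m)
  rw [show a + ((2 * m + 1 : ℕ) : ℝ) = a + 1 + (2 * m : ℕ) by push_cast; ring,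
    cylinderIntegral_add_two_mul_zero (by linarith), h2, add_comm a 1, Complex.ofReal_div,
    Complex.ofReal_mul, Complex.ofReal_natCast]
  generalize (((ascPochhammer ℝ m).eval (3 / 2) : ℝ) : ℂ) = p at h3 ⊢
  generalize (((ascPochhammer ℝ m).eval ((1 + a) / 2) : ℝ) : ℂ) = q
  generalize (m ! : ℂ) = l at hm ⊢
  rw [div_pow, pow_succ, pow_succ, pow_mul, pow_mul, h4, neg_one_sq, one_pow]
  field_simp

lemma hasSum_eq_tsum_even_add_odd {f : ℕ → ℂ} {S : ℂ} (h : HasSum f S) :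
    S = ∑' m, f (2 * m) + ∑' m, f (2 * m + 1) := by
  rw [← h.tsum_eq]
  refine (tsum_even_add_odd ?_ ?_).symm
  · exact h.summable.comp_injective (i := fun m : ℕ => 2 * m) fun m n h => by simpa using h
  · exact h.summable.comp_injective (i := fun m : ℕ => 2 * m + 1) fun m n h => by simpa using h

/-- The Taylor coefficients of I_a at 0 are (-1)^k I_{a+k}(0)/k!; the even and the odd ones sum to
the two Kummer series. -/
lemma cylinderIntegral_eq_kummerM {a : ℝ} (ha : 0 < a) (z : ℂ) :
    cylinderIntegral a z = cylinderIntegral a 0 * kummerM (a / 2) (1 / 2) (z ^ 2 / 2) -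
      z * cylinderIntegral (a + 1) 0 * kummerM ((1 + a) / 2) (3 / 2) (z ^ 2 / 2) := by
  rw [hasSum_eq_tsum_even_add_odd (hasSum_cylinderIntegral ha z),
    tsum_congr (taylor_term_even ha z), tsum_congr (taylor_term_odd ha z),
    tsum_mul_left, tsum_neg, tsum_mul_left, ← sub_eq_add_neg]
  rfl

/-- Legendre's duplication formula. This lemma and the next turn I_a(0)/Γ(a) and I_{a+1}(0)/Γ(a)
into the coefficients in the definition of D_{-a}. -/
lemma two_rpow_mul_Gamma_half_div_Gamma {a : ℝ} (ha : 0 < a) :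
    2 ^ (a / 2 - 1) * Real.Gamma (a / 2) / Real.Gamma a =
      2 ^ (-a / 2) * (√Real.pi * (Real.Gamma ((1 + a) / 2))⁻¹) := by
  have h := Real.Gamma_mul_Gamma_add_half (a / 2)
  rw [show 2 * (a / 2) = a by ring, show a / 2 + 1 / 2 = (1 + a) / 2 by ring] at h
  have g1 := (Real.Gamma_pos_of_pos ha).ne'
  have g2 := (Real.Gamma_pos_of_pos (show 0 < (1 + a) / 2 by linarith)).ne'
  have e : (2 : ℝ) ^ (a / 2 - 1) * 2 ^ (1 - a) = 2 ^ (-a / 2) := by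
    rw [← Real.rpow_add (by norm_num)]; ring_nf
  rw [← e, div_eq_iff g1, ← mul_left_inj' g2]
  calc _ = 2 ^ (a / 2 - 1) * (Real.Gamma (a / 2) * Real.Gamma ((1 + a) / 2)) := by ring
    _ = _ := by rw [h]; field_simp

lemma two_rpow_mul_Gamma_half_add_div_Gamma {a : ℝ} (ha : 0 < a) :
    2 ^ ((a + 1) / 2 - 1) * Real.Gamma ((a + 1) / 2) / Real.Gamma a =
      2 ^ (-a / 2) * (√(2 * Real.pi) * (Real.Gamma (a / 2))⁻¹) := by
  have h := Real.Gamma_mul_Gamma_add_half (a / 2)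
  rw [show 2 * (a / 2) = a by ring, show a / 2 + 1 / 2 = (a + 1) / 2 by ring] at h
  have g1 := (Real.Gamma_pos_of_pos ha).ne'
  have g2 := (Real.Gamma_pos_of_pos (show 0 < a / 2 by linarith)).ne'
  have e : (2 : ℝ) ^ ((a + 1) / 2 - 1) * 2 ^ (1 - a) = 2 ^ (-a / 2) * √2 := by
    rw [← Real.rpow_add (by norm_num), Real.sqrt_eq_rpow, ← Real.rpow_add (by norm_num)]; ring_nf
  rw [Real.sqrt_mul (by norm_num), div_eq_iff g1, ← mul_left_inj' g2]
  calc _ = 2 ^ ((a + 1) / 2 - 1) * (Real.Gamma (a / 2) * Real.Gamma ((a + 1) / 2)) := by ring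
    _ = Real.Gamma a * (2 ^ ((a + 1) / 2 - 1) * 2 ^ (1 - a)) * √Real.pi := by rw [h]; ring
    _ = _ := by rw [e]; field_simp

lemma parabolicCylinderD_neg {a : ℝ} (ha : 0 < a) (z : ℂ) :
    parabolicCylinderD (-a) z =
      Complex.exp (-z ^ 2 / 4) * (cylinderIntegral a z / Real.Gamma a) := by
  have h1 := two_rpow_mul_Gamma_half_div_Gamma ha
  have h2 := two_rpow_mul_Gamma_half_add_div_Gamma ha
  have e1 : cylinderIntegral a 0 / Real.Gamma a =
      ((2 ^ (-a / 2) * (√Real.pi * (Real.Gamma ((1 + a) / 2))⁻¹) : ℝ) : ℂ) := by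
    rw [← h1, cylinderIntegral_zero ha]; push_cast; rfl
  have e2 : cylinderIntegral (a + 1) 0 / Real.Gamma a =
      ((2 ^ (-a / 2) * (√(2 * Real.pi) * (Real.Gamma (a / 2))⁻¹) : ℝ) : ℂ) := by
    rw [← h2, cylinderIntegral_zero (by linarith)]; push_cast; rfl
  have e3 : cylinderIntegral a z / Real.Gamma a =
      cylinderIntegral a 0 / Real.Gamma a * kummerM (a / 2) (1 / 2) (z ^ 2 / 2) -
      z * (cylinderIntegral (a + 1) 0 / Real.Gamma a) *
        kummerM ((1 + a) / 2) (3 / 2) (z ^ 2 / 2) := by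
    rw [cylinderIntegral_eq_kummerM ha z]; ring
  rw [e3, e1, e2, parabolicCylinderD]
  simp only [neg_neg, sub_neg_eq_add]
  push_cast
  ring

end CylinderIntegral

/-! ### Growth of I_a along the rays c² = -i. -/

section EnergyBound

open Set Filter Topology

lemma rpow_le_two_rpow_abs_mul {s : ℝ} (hs : 1 ≤ s) (m : ℝ) :
    s ^ m ≤ 2 ^ |m| * (1 + s) ^ m := by
  rcases le_total 0 m with hm | hm
  · have h1 : s ^ m ≤ (1 + s) ^ m := Real.rpow_le_rpow (by linarith) (by linarith) hm
    have h2 : (1 : ℝ) ≤ 2 ^ |m| := Real.one_le_rpow (by norm_num) (abs_nonneg _)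
    have h3 : 0 ≤ (1 + s) ^ m := by positivity
    nlinarith
  · rw [abs_of_nonpos hm]
    have h1 : s ^ m ≤ ((1 + s) / 2) ^ m :=
      Real.rpow_le_rpow_of_nonpos (by linarith) (by linarith) hm
    refine h1.trans_eq ?_
    rw [Real.div_rpow (by linarith) (by norm_num), Real.rpow_neg (by norm_num)]
    field_simp

lemma exists_norm_le_one_add_rpow {f : ℝ → ℂ} (hf : Continuous f) {m M : ℝ} (hM : 0 ≤ M)
    (h : ∀ s, 2 ≤ s → ‖f s‖ ≤ M * s ^ m) :
    ∃ C, 0 ≤ C ∧ ∀ s, 0 ≤ s → ‖f s‖ ≤ C * (1 + s) ^ m := by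
  have hc : ContinuousOn (fun s : ℝ => ‖f s‖ * (1 + s) ^ (-m)) (Icc 0 2) := by
    refine hf.norm.continuousOn.mul (ContinuousOn.rpow_const (by fun_prop) fun s hs => Or.inl ?_)
    have := hs.1
    positivity
  obtain ⟨C, hC⟩ := (isCompact_Icc (a := (0 : ℝ)) (b := 2)).bddAbove_image hc
  refine ⟨max C (M * 2 ^ |m|), le_max_of_le_right (by positivity), fun s hs => ?_⟩
  have hp : 0 < (1 + s) ^ m := by positivity
  rcases le_total s 2 with h2 | h2
  · have := hC (mem_image_of_mem _ (show s ∈ Icc (0 : ℝ) 2 from ⟨hs, h2⟩))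
    simp only [Real.rpow_neg (show 0 ≤ 1 + s by linarith)] at this
    rw [← div_eq_mul_inv, div_le_iff₀ hp] at this
    exact this.trans (by gcongr; exact le_max_left _ _)
  · refine (h s h2).trans ?_
    calc M * s ^ m ≤ M * (2 ^ |m| * (1 + s) ^ m) := by
          gcongr; exact rpow_le_two_rpow_abs_mul (by linarith) m
      _ = M * 2 ^ |m| * (1 + s) ^ m := by ring
      _ ≤ _ := by gcongr; exact le_max_right _ _

/-- Energy estimate for solutions `u + i v` of `h'' = -(s² / 4 + i b) h`. -/
lemma exists_sq_add_sq_le {u v p q : ℝ → ℝ} {b : ℝ} (hu : ∀ s, HasDerivAt u (p s) s)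
    (hv : ∀ s, HasDerivAt v (q s) s)
    (hp : ∀ s, HasDerivAt p (-(s ^ 2 / 4) * u s + b * v s) s)
    (hq : ∀ s, HasDerivAt q (-(s ^ 2 / 4) * v s - b * u s) s) :
    ∃ M, 0 ≤ M ∧ ∀ s, 2 ≤ s → u s ^ 2 + v s ^ 2 ≤ M * s ^ (2 * |b| - 1) := by
  -- Large enough that (c - 2 - 2|b|) s² ≥ c for s ≥ 2, which pays for replacing e by Q in the
  -- differential inequality.
  set c : ℝ := 3 + 4 * |b| with hc
  have hb0 : 0 ≤ |b| := abs_nonneg b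
  -- For h = u + iv, e is the energy |h'|²/s + s|h|²/4. Its derivative contains -|h'|²/s² + |h|²/4,
  -- which is of order e/s whatever b is; the correction Re(h̄ h')/s² in Q cancels exactly these
  -- terms.
  let e : ℝ → ℝ := fun s => (p s ^ 2 + q s ^ 2) / s + s / 4 * (u s ^ 2 + v s ^ 2)
  let Q : ℝ → ℝ := fun s => e s + (u s * p s + v s * q s) / s ^ 2
  -- Integrating factor for Q' ≤ (2|b|/s + c/s³) Q.
  let w : ℝ → ℝ := fun s => s ^ (-(2 * |b|)) * Real.exp (c / (2 * s ^ 2))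
  have he (s : ℝ) (hs : 2 ≤ s) : |p s * v s - q s * u s| ≤ e s ∧
      |u s * p s + v s * q s| ≤ e s ∧ 0 ≤ e s := by
    have hs0 : 0 < s := by linarith
    have key : ∀ x y : ℝ, |x * y| ≤ x ^ 2 / s + s / 4 * y ^ 2 := by
      intro x y
      have h1 : 0 ≤ (x - s / 2 * y) ^ 2 / s := by positivity
      have h2 : 0 ≤ (x + s / 2 * y) ^ 2 / s := by positivity
      have e1 : (x - s / 2 * y) ^ 2 / s = x ^ 2 / s + s / 4 * y ^ 2 - x * y := by
        field_simp; ring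
      have e2 : (x + s / 2 * y) ^ 2 / s = x ^ 2 / s + s / 4 * y ^ 2 + x * y := by
        field_simp; ring
      rw [abs_le]; constructor <;> linarith
    have e3 : e s = p s ^ 2 / s + s / 4 * v s ^ 2 + (q s ^ 2 / s + s / 4 * u s ^ 2) := by
      simp only [e]; ring
    have e4 : e s = p s ^ 2 / s + s / 4 * u s ^ 2 + (q s ^ 2 / s + s / 4 * v s ^ 2) := by
      simp only [e]; ring
    refine ⟨?_, ?_, ?_⟩
    · rw [e3]
      exact (abs_sub _ _).trans (add_le_add (key _ _) (key _ _))
    · rw [e4, mul_comm (u s), mul_comm (v s)]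
      exact (abs_add_le _ _).trans (add_le_add (key _ _) (key _ _))
    · simp only [e]; positivity
  have hQ (s : ℝ) (hs : 2 ≤ s) : HasDerivAt Q
      (2 * b * (p s * v s - q s * u s) / s - 2 * (u s * p s + v s * q s) / s ^ 3) s := by
    have hs0 : s ≠ 0 := by linarith
    have h1 := ((((hp s).pow 2).add ((hq s).pow 2)).div (hasDerivAt_id s) hs0).add
      (((hasDerivAt_id s).div_const 4).mul (((hu s).pow 2).add ((hv s).pow 2)))
    have h2 := (((hu s).mul (hp s)).add ((hv s).mul (hq s))).div ((hasDerivAt_id s).pow 2)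
      (pow_ne_zero 2 hs0)
    refine (h1.add h2).congr_deriv ?_
    simp
    field_simp
    ring
  have hw (s : ℝ) (hs : 2 ≤ s) : HasDerivAt w (w s * (-(2 * |b|) / s - c / s ^ 3)) s := by
    have hs0 : s ≠ 0 := by linarith
    have h1 : HasDerivAt (fun s : ℝ => s ^ (-(2 * |b|)))
        (-(2 * |b|) * s ^ (-(2 * |b|) - 1)) s := Real.hasDerivAt_rpow_const (Or.inl hs0)
    have h2 := ((hasDerivAt_const s c).div (((hasDerivAt_id s).pow 2).const_mul 2)
      (by simpa using hs0)).exp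
    refine (h1.mul h2).congr_deriv ?_
    rw [Real.rpow_sub_one hs0]
    simp [w]
    field_simp
    ring
  have hanti : AntitoneOn (fun s => Q s * w s) (Ici 2) := by
    have hd (s : ℝ) (hs : 2 ≤ s) := (hQ s hs).mul (hw s hs)
    refine antitoneOn_of_deriv_nonpos (convex_Ici 2)
      (fun s hs => (hd s hs).continuousAt.continuousWithinAt)
      (fun s hs => ?_) (fun s hs => ?_)
    · rw [interior_Ici] at hs
      exact (hd s (le_of_lt hs)).differentiableAt.differentiableWithinAt
    · rw [interior_Ici] at hs
      have hs2 : 2 ≤ s := le_of_lt hs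
      have hs0 : 0 < s := by linarith
      rw [show (fun s => Q s * w s) = Q * w from rfl, (hd s hs2).deriv]
      have hw0 : 0 ≤ w s := by simp only [w]; positivity
      obtain ⟨h1, h2, h3⟩ := he s hs2
      suffices H : 2 * b * (p s * v s - q s * u s) / s - 2 * (u s * p s + v s * q s) / s ^ 3
          ≤ (2 * |b| / s + c / s ^ 3) * Q s by
        have : (2 * |b| / s + c / s ^ 3) * Q s - (2 * b * (p s * v s - q s * u s) / s
          - 2 * (u s * p s + v s * q s) / s ^ 3) ≥ 0 := by linarith
        have := mul_nonneg this hw0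
        have e : -(2 * |b|) / s = -(2 * |b| / s) := by ring
        rw [e]
        nlinarith
      have hA : 2 * b * (p s * v s - q s * u s) ≤ 2 * |b| * e s := by
        refine (le_abs_self _).trans ?_
        rw [abs_mul, abs_mul, abs_two]
        gcongr
      have hB : -(2 * (u s * p s + v s * q s)) ≤ 2 * e s := by
        have := (abs_le.1 h2).1
        linarith
      have hQe : e s * (1 - 1 / s ^ 2) ≤ Q s := by
        have := (abs_le.1 h2).1
        have h4 : -(e s / s ^ 2) ≤ (u s * p s + v s * q s) / s ^ 2 := by
          rw [← neg_div]; gcongr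
        have : e s * (1 - 1 / s ^ 2) = e s - e s / s ^ 2 := by ring
        simp only [Q]
        linarith
      have hk : 2 * |b| / s + 2 / s ^ 3 ≤ (2 * |b| / s + c / s ^ 3) * (1 - 1 / s ^ 2) := by
        have : (2 * |b| / s + c / s ^ 3) * (1 - 1 / s ^ 2) - (2 * |b| / s + 2 / s ^ 3) =
            ((c - 2 - 2 * |b|) * s ^ 2 - c) / s ^ 5 := by
          field_simp
          ring
        have h5 : 0 ≤ ((c - 2 - 2 * |b|) * s ^ 2 - c) / s ^ 5 := by
          apply div_nonneg _ (by positivity)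
          have : 4 ≤ s ^ 2 := by nlinarith
          rw [hc]
          nlinarith
        linarith
      calc _ = 2 * b * (p s * v s - q s * u s) / s + -(2 * (u s * p s + v s * q s)) / s ^ 3 := by
            ring
        _ ≤ 2 * |b| * e s / s + 2 * e s / s ^ 3 := by gcongr
        _ = (2 * |b| / s + 2 / s ^ 3) * e s := by ring
        _ ≤ (2 * |b| / s + c / s ^ 3) * (1 - 1 / s ^ 2) * e s := by gcongr
        _ = (2 * |b| / s + c / s ^ 3) * (e s * (1 - 1 / s ^ 2)) := by ring
        _ ≤ _ := by gcongr
  have hQ34 (s : ℝ) (hs : 2 ≤ s) : 3 / 4 * e s ≤ Q s := by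
    obtain ⟨h1, h2, h3⟩ := he s hs
    have := (abs_le.1 h2).1
    have h4 : -(e s / s ^ 2) ≤ (u s * p s + v s * q s) / s ^ 2 := by
      rw [← neg_div]; gcongr
    have h5 : e s / s ^ 2 ≤ e s / 4 := by
      gcongr
      nlinarith
    simp only [Q]
    linarith
  have hQ2 : 0 ≤ Q 2 := le_trans (by have := (he 2 le_rfl).2.2; positivity) (hQ34 2 le_rfl)
  -- The factor 16/3 is 4/3 from (3/4) e ≤ Q times 4 from (s/4)|h|² ≤ e.
  refine ⟨16 / 3 * (Q 2 * w 2), by simp only [w]; positivity, fun s hs => ?_⟩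
  have hs0 : 0 < s := by linarith
  have h := hanti (mem_Ici.2 (le_refl (2 : ℝ))) (show s ∈ Ici (2 : ℝ) from hs) hs
  have hw1 : s ^ (-(2 * |b|)) ≤ w s := by
    simp only [w]
    refine le_mul_of_one_le_right (by positivity) (Real.one_le_exp (by positivity))
  have h1 := hQ34 s hs
  have h3 := (he s hs).2.2
  have h2 : s / 4 * (u s ^ 2 + v s ^ 2) ≤ e s := by
    simp only [e]
    have : 0 ≤ (p s ^ 2 + q s ^ 2) / s := by positivity
    linarith
  have h4 : 3 / 4 * (s / 4 * (u s ^ 2 + v s ^ 2)) * s ^ (-(2 * |b|)) ≤ Q 2 * w 2 := by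
    refine le_trans ?_ h
    exact mul_le_mul (le_trans (by gcongr) h1) hw1 (by positivity)
      (le_trans (by positivity) h1)
  rw [Real.rpow_neg hs0.le, ← div_eq_mul_inv, div_le_iff₀ (by positivity)] at h4
  rw [Real.rpow_sub_one hs0.ne', ← mul_div_assoc, le_div_iff₀ hs0]
  linarith

lemma exists_norm_le_of_hasDerivAt {h h' : ℝ → ℂ} {b : ℝ} (h1 : ∀ s, HasDerivAt h (h' s) s)
    (h2 : ∀ s : ℝ, HasDerivAt h' (-((s : ℂ) ^ 2 / 4 + Complex.I * b) * h s) s) :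
    ∃ C, 0 ≤ C ∧ ∀ s, 0 ≤ s → ‖h s‖ ≤ C * (1 + s) ^ (|b| - 1 / 2) := by
  have re_d {f : ℝ → ℂ} {f' : ℂ} {s : ℝ} (hf : HasDerivAt f f' s) :
      HasDerivAt (fun s => (f s).re) f'.re s :=
    (Complex.reCLM.hasFDerivAt.comp_hasDerivAt s hf)
  have im_d {f : ℝ → ℂ} {f' : ℂ} {s : ℝ} (hf : HasDerivAt f f' s) :
      HasDerivAt (fun s => (f s).im) f'.im s :=
    (Complex.imCLM.hasFDerivAt.comp_hasDerivAt s hf)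
  have hsq (s : ℝ) : ((s : ℂ) ^ 2 / 4) = ((s ^ 2 / 4 : ℝ) : ℂ) := by push_cast; rfl
  obtain ⟨M, hM, H⟩ := exists_sq_add_sq_le (b := b) (fun s => re_d (h1 s)) (fun s => im_d (h1 s))
    (fun s => (re_d (h2 s)).congr_deriv (by
      rw [hsq]
      simp only [Complex.neg_re, Complex.neg_im, Complex.mul_re,
        Complex.mul_im, Complex.add_re, Complex.add_im, Complex.ofReal_re, Complex.ofReal_im,
        Complex.I_re, Complex.I_im]
      ring))
    (fun s => (im_d (h2 s)).congr_deriv (by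
      rw [hsq]
      simp only [Complex.neg_re, Complex.neg_im, Complex.mul_re,
        Complex.mul_im, Complex.add_re, Complex.add_im, Complex.ofReal_re, Complex.ofReal_im,
        Complex.I_re, Complex.I_im]
      ring))
  refine exists_norm_le_one_add_rpow
    (continuous_iff_continuousAt.2 fun s => (h1 s).continuousAt) (Real.sqrt_nonneg M)
    fun s hs => ?_
  have hs0 : 0 < s := by linarith
  have e : s ^ (2 * |b| - 1) = (s ^ (|b| - 1 / 2)) ^ 2 := by
    rw [← Real.rpow_natCast, ← Real.rpow_mul hs0.le]
    norm_num
    ring_nf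
  rw [← Real.sqrt_sq (norm_nonneg _), ← Real.sqrt_sq (show 0 ≤ s ^ (|b| - 1 / 2) by positivity),
    ← Real.sqrt_mul hM, ← e]
  refine Real.sqrt_le_sqrt ?_
  rw [Complex.sq_norm, Complex.normSq_apply]
  simpa [sq] using H s hs

/-- The derivative of `s ↦ I_a(c s)`. -/
lemma hasDerivAt_cylinderIntegral_comp {a : ℝ} (ha : 0 < a) (c : ℂ) (s : ℝ) :
    HasDerivAt (fun s : ℝ => cylinderIntegral a (c * s)) (-(c * cylinderIntegral (a + 1) (c * s)))
      s := by
  have h1 : HasDerivAt (fun s : ℝ => c * (s : ℂ)) c s := by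
    simpa using (Complex.ofRealCLM.hasDerivAt (x := s)).const_mul c
  refine ((hasDerivAt_cylinderIntegral ha (c * s)).comp s h1).congr_deriv ?_
  ring

/-- Multiplication by exp(is²/4), of modulus one, removes the first-order term from the equation of
I_a(cs). What remains is h'' = -(s²/4 + ib)h with b = a - 1/2, to which the energy estimate applies.
-/
lemma exists_norm_cylinderIntegral_le {a : ℝ} (ha : 0 < a) {c : ℂ} (hc : c ^ 2 = -Complex.I) :
    ∃ C, 0 ≤ C ∧ ∀ s : ℝ, 0 ≤ s →
      ‖cylinderIntegral a (c * s)‖ ≤ C * (1 + s) ^ (|a - 1 / 2| - 1 / 2) := by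
  let E : ℝ → ℂ := fun s => Complex.exp (Complex.I * (s : ℂ) ^ 2 / 4)
  have hE (s : ℝ) : HasDerivAt E (E s * (Complex.I * s / 2)) s := by
    have h1 : HasDerivAt (fun z : ℂ => Complex.I * z ^ 2 / 4) (Complex.I * s / 2) (s : ℂ) := by
      refine ((((hasDerivAt_id (s : ℂ)).pow 2).const_mul Complex.I).div_const 4).congr_deriv ?_
      simp
      ring
    exact h1.cexp.comp_ofReal
  let h : ℝ → ℂ := fun s => E s * cylinderIntegral a (c * s)
  let h' : ℝ → ℂ := fun s => E s * (Complex.I * s / 2) * cylinderIntegral a (c * s) +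
    E s * (-(c * cylinderIntegral (a + 1) (c * s)))
  have d1 (s : ℝ) : HasDerivAt h (h' s) s :=
    (hE s).mul (hasDerivAt_cylinderIntegral_comp ha c s)
  have d2 (s : ℝ) : HasDerivAt h'
      (-((s : ℂ) ^ 2 / 4 + Complex.I * ((a - 1 / 2 : ℝ) : ℂ)) * h s) s := by
    have hs1 : HasDerivAt (fun s : ℝ => Complex.I * (s : ℂ) / 2) (Complex.I / 2) s := by
      simpa using ((Complex.ofRealCLM.hasDerivAt (x := s)).const_mul Complex.I).div_const 2
    have := (((hE s).mul hs1).mul (hasDerivAt_cylinderIntegral_comp ha c s)).add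
      ((hE s).mul (((hasDerivAt_cylinderIntegral_comp (show 0 < a + 1 by linarith) c s).const_mul
        c).neg))
    refine this.congr_deriv ?_
    have hrec := cylinderIntegral_add_two ha (c * s)
    rw [show a + 1 + 1 = a + 2 by ring, hrec]
    simp only [h, Pi.mul_apply, Pi.neg_apply]
    push_cast
    generalize cylinderIntegral a (c * s) = f0
    generalize cylinderIntegral (a + 1) (c * s) = f1
    linear_combination E s * (a * f0 - c * s * f1) * hc +
      E s * (s : ℂ) ^ 2 * f0 / 4 * Complex.I_sq
  obtain ⟨C, hC, H⟩ := exists_norm_le_of_hasDerivAt d1 d2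
  refine ⟨C, hC, fun s hs => ?_⟩
  have hn : ‖E s‖ = 1 := by
    have : Complex.I * (s : ℂ) ^ 2 / 4 = ((s ^ 2 / 4 : ℝ) : ℂ) * Complex.I := by push_cast; ring
    simp only [E]
    rw [this, Complex.norm_exp_ofReal_mul_I]
  simpa [h, hn] using H s hs

/-- If some a_j ≥ 1/2, its term is already 1 and another index, present because n ≥ 2, adds
something positive. Otherwise the sum is 2∑ a_j > 2. -/
lemma sum_min_one_two_mul_gt {n : ℕ} (hn : 2 ≤ n) {a : Fin n → ℝ} (ha : ∀ j, 0 < a j)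
    (hsum : 1 < ∑ j, a j) : 1 < ∑ j, min 1 (2 * a j) := by
  have hpos (j : Fin n) : 0 < min 1 (2 * a j) := lt_min one_pos (by linarith [ha j])
  by_cases h : ∃ j, 1 ≤ 2 * a j
  · obtain ⟨j, hj⟩ := h
    have : Nontrivial (Fin n) := Fin.nontrivial_iff_two_le.2 hn
    obtain ⟨k, hk⟩ := exists_ne j
    rw [← Finset.add_sum_erase _ _ (Finset.mem_univ j), min_eq_left hj]
    have : 0 < ∑ i ∈ Finset.univ.erase j, min 1 (2 * a i) :=
      Finset.sum_pos (fun i _ => hpos i) ⟨k, by simp [hk]⟩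
    linarith
  · push Not at h
    rw [Finset.sum_congr rfl fun j _ => min_eq_right (h j).le, ← Finset.mul_sum]
    linarith

lemma abs_sub_half_sub_half_sub (a : ℝ) : |a - 1 / 2| - 1 / 2 - a = -min 1 (2 * a) := by
  rcases le_total 1 (2 * a) with h | h
  · rw [min_eq_left h, abs_of_nonneg (by linarith)]; ring
  · rw [min_eq_right h, abs_of_nonpos (by linarith)]; ring

/-- The product of the functions `I_{a_j}` decays along a ray `c² = -i` fast enough to compensate
the decay `s ^ (-∑ a_j)` of the kernel. -/
lemma exists_norm_prod_cylinderIntegral_le {n : ℕ} (hn : 2 ≤ n) {a : Fin n → ℝ}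
    (ha : ∀ j, 0 < a j) (hsum : 1 < ∑ j, a j) {c : ℂ} (hc : c ^ 2 = -Complex.I) :
    ∃ C β : ℝ, 0 ≤ C ∧ 1 < β ∧ ∀ s : ℝ, 0 ≤ s →
      ‖∏ j, cylinderIntegral (a j) (c * s)‖ ≤ C * (1 + s) ^ (∑ j, a j - β) := by
  choose C hC H using fun j => exists_norm_cylinderIntegral_le (ha j) hc
  refine ⟨∏ j, C j, ∑ j, min 1 (2 * a j), Finset.prod_nonneg fun j _ => hC j,
    sum_min_one_two_mul_gt hn ha hsum, fun s hs => ?_⟩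
  rw [norm_prod, ← Finset.sum_sub_distrib, Real.rpow_sum_of_pos (by linarith),
    ← Finset.prod_mul_distrib]
  refine Finset.prod_le_prod (fun j _ => norm_nonneg _) fun j _ => ?_
  have := abs_sub_half_sub_half_sub (a j)
  rw [show a j - min 1 (2 * a j) = |a j - 1 / 2| - 1 / 2 by linarith]
  exact H j s hs

end EnergyBound

/-! ### Independent gamma variables: sum and direction, and the law of the self-normalised sum. -/

section GammaVectors

open Set Filter Topology
open scoped ENNReal

lemma gammaMeasure_absolutelyContinuous (a r : ℝ) : gammaMeasure a r ≪ volume :=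
  withDensity_absolutelyContinuous _ _

lemma measurable_gammaPDF (a r : ℝ) : Measurable (gammaPDF a r) :=
  (measurable_gammaPDFReal a r).ennreal_ofReal

lemma ae_pos_gammaMeasure (a r : ℝ) : ∀ᵐ t ∂gammaMeasure a r, 0 < t := by
  rw [gammaMeasure, ae_withDensity_iff (measurable_gammaPDF a r)]
  filter_upwards [Measure.ae_ne volume (0 : ℝ)] with t ht h
  by_contra h0
  exact h (gammaPDF_of_neg (lt_of_le_of_ne (not_lt.1 h0) ht))

lemma integral_gammaMeasure {a : ℝ} (ha : 0 < a) (f : ℝ → ℂ) :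
    ∫ t, f t ∂gammaMeasure a 1 =
      (∫ t in Ioi (0 : ℝ), ((t ^ (a - 1) * Real.exp (-t) : ℝ) : ℂ) * f t) / Real.Gamma a := by
  have hΓ := Real.Gamma_pos_of_pos ha
  rw [gammaMeasure, integral_withDensity_eq_integral_toReal_smul (measurable_gammaPDF a 1)
    (ae_of_all _ fun t => ENNReal.ofReal_lt_top), div_eq_inv_mul, ← integral_const_mul,
    ← integral_indicator measurableSet_Ioi]
  refine integral_congr_ae ?_
  filter_upwards [Measure.ae_ne volume (0 : ℝ)] with t ht
  rcases lt_or_gt_of_ne ht with h | h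
  · rw [gammaPDF_of_neg h, indicator_of_notMem (by simpa using h.le)]
    simp
  · rw [gammaPDF_of_nonneg h.le, indicator_of_mem (by simpa using h),
      ENNReal.toReal_ofReal (by positivity), Complex.real_smul, Real.one_rpow]
    push_cast
    ring_nf

/-- Substitution u ↦ tu: the weight is the Jacobian t times the ratio of the gamma densities at tu
and u. -/
lemma lintegral_gammaMeasure_comp_mul {a t : ℝ} (ha : 0 < a) (ht : 0 < t) {f : ℝ → ℝ≥0∞}
    (hf : Measurable f) :
    ∫⁻ u, f u ∂gammaMeasure a 1 =
      ∫⁻ u, f (t * u) * ENNReal.ofReal (t ^ a * Real.exp (-(t - 1) * u)) ∂gammaMeasure a 1 := by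
  have hm := measurable_gammaPDF a 1
  rw [gammaMeasure, lintegral_withDensity_eq_lintegral_mul _ hm hf,
    lintegral_withDensity_eq_lintegral_mul _ hm (by fun_prop),
    ← Real.smul_map_volume_mul_left ht.ne', lintegral_smul_measure,
    lintegral_map (hm.mul hf) (by fun_prop), smul_eq_mul, ← lintegral_const_mul _ (by fun_prop),
    Real.smul_map_volume_mul_left ht.ne']
  refine lintegral_congr fun u => ?_
  simp only [Pi.mul_apply]
  rw [abs_of_pos ht]
  rcases lt_or_ge u 0 with h | h
  · rw [gammaPDF_of_neg h, gammaPDF_of_neg (mul_neg_of_pos_of_neg ht h)]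
    simp
  · rw [gammaPDF_of_nonneg h, gammaPDF_of_nonneg (by positivity), ← mul_assoc,
      ← ENNReal.ofReal_mul ht.le, mul_comm (f _), ← mul_assoc (ENNReal.ofReal _),
      ← ENNReal.ofReal_mul (by positivity)]
    congr 2
    have e1 : t ^ a = t ^ (a - 1) * t := by rw [← Real.rpow_add_one ht.ne']; ring_nf
    have e2 : Real.exp (-(1 * u)) * Real.exp (-(t - 1) * u) = Real.exp (-(1 * (t * u))) := by
      rw [← Real.exp_add]; ring_nf
    rw [Real.mul_rpow ht.le h, e1, ← e2]
    ring

variable {n : ℕ} {a : Fin n → ℝ}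

/-- The joint law of independent gamma variables of orders `a j` and rate `1`. -/
noncomputable def gammaPi (a : Fin n → ℝ) : Measure (Fin n → ℝ) :=
  Measure.pi fun j => gammaMeasure (a j) 1

instance sigmaFinite_gammaMeasure (a r : ℝ) : SigmaFinite (gammaMeasure a r) :=
  SigmaFinite.withDensity_ofReal _

lemma isProbabilityMeasure_gammaPi (ha : ∀ j, 0 < a j) : IsProbabilityMeasure (gammaPi a) := by
  have (j : Fin n) := isProbabilityMeasure_gammaMeasure (ha j) one_pos
  unfold gammaPi
  infer_instance

lemma ae_pos_gammaPi (ha : ∀ j, 0 < a j) : ∀ᵐ y ∂gammaPi a, ∀ j, 0 < y j := by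
  have (j : Fin n) := isProbabilityMeasure_gammaMeasure (ha j) one_pos
  rw [ae_all_iff]
  intro j
  exact (Measure.quasiMeasurePreserving_eval (fun j => gammaMeasure (a j) 1) j).ae
    (ae_pos_gammaMeasure (a j) 1)

lemma ae_sum_pos_gammaPi (hn : 0 < n) (ha : ∀ j, 0 < a j) :
    ∀ᵐ y ∂gammaPi a, 0 < ∑ j, y j := by
  filter_upwards [ae_pos_gammaPi ha] with y hy
  exact Finset.sum_pos (fun j _ => hy j) ⟨⟨0, hn⟩, Finset.mem_univ _⟩

lemma gammaPi_eq_map_withDensity (ha : ∀ j, 0 < a j) {t : ℝ} (ht : 0 < t) :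
    gammaPi a = ((gammaPi a).withDensity fun y =>
      ∏ j, ENNReal.ofReal (t ^ a j * Real.exp (-(t - 1) * y j))).map fun y j => t * y j := by
  have hp (j : Fin n) := isProbabilityMeasure_gammaMeasure (ha j) one_pos
  have hind := iIndepFun_pi (μ := fun j => gammaMeasure (a j) 1) (X := fun _ x => x)
    (fun j => aemeasurable_id)
  refine Measure.pi_eq fun s hs => ?_
  let g : (j : Fin n) → ℝ → ℝ≥0∞ := fun j u =>
    (s j).indicator 1 (t * u) * ENNReal.ofReal (t ^ a j * Real.exp (-(t - 1) * u))
  have hi (j : Fin n) : Measurable ((s j).indicator (1 : ℝ → ℝ≥0∞)) :=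
    measurable_one.indicator (hs j)
  have hg (j : Fin n) : Measurable (g j) := by
    have := (hi j).comp (measurable_const_mul t)
    exact this.mul (by fun_prop)
  rw [Measure.map_apply (by fun_prop) (MeasurableSet.univ_pi hs), withDensity_apply _
    ((MeasurableSet.univ_pi hs).preimage (by fun_prop)), ← lintegral_indicator
    ((MeasurableSet.univ_pi hs).preimage (by fun_prop))]
  have e : ∀ y : Fin n → ℝ, ((fun (y : Fin n → ℝ) j => t * y j) ⁻¹' univ.pi s).indicator
      (fun y => ∏ j, ENNReal.ofReal (t ^ a j * Real.exp (-(t - 1) * y j))) y =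
      ∏ j, g j (y j) := by
    intro y
    by_cases h : ∀ j, t * y j ∈ s j
    · rw [indicator_of_mem (by simpa using h)]
      refine Finset.prod_congr rfl fun j _ => ?_
      simp [g, h j]
    · rw [indicator_of_notMem (by simpa using h)]
      push Not at h
      obtain ⟨j, hj⟩ := h
      rw [Finset.prod_eq_zero (Finset.mem_univ j)]
      simp [g, hj]
  simp_rw [e]
  rw [gammaPi, lintegral_prod_eq_prod_lintegral_of_indepFun Finset.univ
    (fun j (y : Fin n → ℝ) => g j (y j)) (hind.comp g hg)
    (fun j => (hg j).comp (measurable_pi_apply j))]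
  refine Finset.prod_congr rfl fun j _ => ?_
  rw [← lintegral_indicator_one (hs j), lintegral_gammaMeasure_comp_mul (ha j) ht (hi j)]
  exact (measurePreserving_eval (fun j => gammaMeasure (a j) 1) j).lintegral_comp (hg j)

lemma prod_ofReal_gamma_weight {t : ℝ} (ht : 0 < t) (y : Fin n → ℝ) :
    ∏ j, ENNReal.ofReal (t ^ a j * Real.exp (-(t - 1) * y j)) =
      ENNReal.ofReal (t ^ (∑ j, a j) * Real.exp (-(t - 1) * ∑ j, y j)) := by
  rw [← ENNReal.ofReal_prod_of_nonneg (fun j _ => by positivity), Finset.prod_mul_distrib,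
    Real.rpow_sum_of_pos ht, ← Real.exp_sum, Finset.mul_sum]

lemma lintegral_gammaPi_comp_mul (ha : ∀ j, 0 < a j) {t : ℝ} (ht : 0 < t)
    {f : (Fin n → ℝ) → ℝ≥0∞} (hf : Measurable f) :
    ∫⁻ y, f y ∂gammaPi a = ∫⁻ y, f (fun j => t * y j) *
      ENNReal.ofReal (t ^ (∑ j, a j) * Real.exp (-(t - 1) * ∑ j, y j)) ∂gammaPi a := by
  have h1 : Measurable fun y : Fin n → ℝ => fun j => t * y j := by fun_prop
  conv_lhs => rw [gammaPi_eq_map_withDensity ha ht]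
  rw [lintegral_map hf h1]
  refine (lintegral_withDensity_eq_lintegral_mul _ (by fun_prop) (hf.comp h1)).trans
    (lintegral_congr fun y => ?_)
  rw [Pi.mul_apply, prod_ofReal_gamma_weight ht, mul_comm, Function.comp_apply]

/-- If `ρ` has the gamma law of order `∑ a j` and is independent of `Y`, then rescaling `Y` so that
its sum becomes `ρ` does not change the law of `Y`. -/
lemma lintegral_gammaPi_polar (hn : 0 < n) (ha : ∀ j, 0 < a j) {f : (Fin n → ℝ) → ℝ≥0∞}
    (hf : Measurable f) :
    ∫⁻ y, ∫⁻ r, f (fun j => r / (∑ i, y i) * y j) ∂gammaMeasure (∑ j, a j) 1 ∂gammaPi a =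
      ∫⁻ y, f y ∂gammaPi a := by
  have hα : 0 < ∑ j, a j := Finset.sum_pos (fun j _ => ha j) ⟨⟨0, hn⟩, Finset.mem_univ _⟩
  set α := ∑ j, a j with hαdef
  have hpγ := isProbabilityMeasure_gammaMeasure hα one_pos
  have hpμ := isProbabilityMeasure_gammaPi ha
  -- Scalings alone show that the left side is D times the right side, with D independent of f. No
  -- polar Jacobian is needed: f = 1 then forces D = 1.
  let D : ℝ≥0∞ := ∫⁻ r, ENNReal.ofReal (r ^ (-(2 * α)) * Real.exp (r - 1 / r)) ∂gammaMeasure α 1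
  have hS := ae_sum_pos_gammaPi hn ha
  have hr := ae_pos_gammaMeasure α 1
  have key {f : (Fin n → ℝ) → ℝ≥0∞} (hf : Measurable f) :
      ∫⁻ y, ∫⁻ r, f (fun j => r / (∑ i, y i) * y j) ∂gammaMeasure α 1 ∂gammaPi a =
        (∫⁻ y, f y ∂gammaPi a) * D := by
    -- Replace r by r∑y_i, so that f is evaluated at ry.
    have h1 : ∀ᵐ y ∂gammaPi a, ∫⁻ r, f (fun j => r / (∑ i, y i) * y j) ∂gammaMeasure α 1 =
        ∫⁻ r, f (fun j => r * y j) *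
          ENNReal.ofReal ((∑ i, y i) ^ α * Real.exp (-((∑ i, y i) - 1) * r)) ∂gammaMeasure α 1 := by
      filter_upwards [hS] with y hy
      rw [lintegral_gammaMeasure_comp_mul hα hy
        (f := fun r => f (fun j => r / (∑ i, y i) * y j)) (hf.comp (by fun_prop))]
      refine lintegral_congr fun r => ?_
      rw [mul_div_cancel_left₀ _ hy.ne']
    -- With r fixed, undo the scaling of y: f is now evaluated at y and r survives only in the
    -- weight.
    have h2 : ∀ᵐ r ∂gammaMeasure α 1, ∫⁻ y, f (fun j => r * y j) *
          ENNReal.ofReal ((∑ i, y i) ^ α * Real.exp (-((∑ i, y i) - 1) * r)) ∂gammaPi a =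
        ∫⁻ y, f y * ENNReal.ofReal ((∑ i, y i) ^ α * r ^ (-(2 * α)) *
          Real.exp (r - (∑ i, y i) / r)) ∂gammaPi a := by
      filter_upwards [hr] with r hr
      rw [lintegral_gammaPi_comp_mul ha hr (f := fun y => f y * ENNReal.ofReal
        ((∑ i, y i) ^ α * r ^ (-(2 * α)) * Real.exp (r - (∑ i, y i) / r)))
        (hf.mul (by fun_prop))]
      refine lintegral_congr_ae ?_
      filter_upwards [hS] with y hy
      rw [mul_assoc, ← Finset.mul_sum, ← ENNReal.ofReal_mul (by positivity),
        mul_div_cancel_left₀ _ hr.ne', Real.mul_rpow hr.le hy.le]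
      congr 2
      rw [← hαdef]
      have e1 : r ^ α * r ^ (-(2 * α)) * r ^ α = 1 := by
        rw [← Real.rpow_add hr, ← Real.rpow_add hr]; ring_nf; simp
      have e2 : Real.exp (r - ∑ i, y i) * Real.exp (-(r - 1) * ∑ i, y i) =
          Real.exp (-((∑ i, y i) - 1) * r) := by
        rw [← Real.exp_add]; ring_nf
      rw [← e2]
      linear_combination -((∑ i, y i) ^ α * Real.exp (r - ∑ i, y i) *
        Real.exp (-(r - 1) * ∑ i, y i)) * e1
    -- Rescaling r by ∑y_i once more removes the sum from the weight and leaves D.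
    have h3 : ∀ᵐ y ∂gammaPi a, ∫⁻ r, f y * ENNReal.ofReal ((∑ i, y i) ^ α * r ^ (-(2 * α)) *
          Real.exp (r - (∑ i, y i) / r)) ∂gammaMeasure α 1 = f y * D := by
      filter_upwards [hS] with y hy
      rw [lintegral_const_mul _ (by fun_prop), lintegral_gammaMeasure_comp_mul hα hy (by fun_prop)]
      congr 1
      refine lintegral_congr_ae ?_
      filter_upwards [hr] with r hr
      rw [← ENNReal.ofReal_mul (by positivity), Real.mul_rpow hy.le hr.le]
      congr 1
      have e1 : (∑ i, y i) ^ α * (∑ i, y i) ^ (-(2 * α)) * (∑ i, y i) ^ α = 1 := by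
        rw [← Real.rpow_add hy, ← Real.rpow_add hy]; ring_nf; simp
      have e2 : Real.exp ((∑ i, y i) * r - (∑ i, y i) / ((∑ i, y i) * r)) *
          Real.exp (-((∑ i, y i) - 1) * r) = Real.exp (r - 1 / r) := by
        rw [← Real.exp_add]
        congr 1
        field_simp
        ring
      rw [← e2]
      linear_combination (r ^ (-(2 * α)) *
        Real.exp ((∑ i, y i) * r - (∑ i, y i) / ((∑ i, y i) * r)) *
          Real.exp (-((∑ i, y i) - 1) * r)) * e1
    rw [lintegral_congr_ae h1, lintegral_lintegral_swap, lintegral_congr_ae h2,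
      lintegral_lintegral_swap, lintegral_congr_ae h3, lintegral_mul_const _ hf]
    · exact Measurable.aemeasurable
        (Measurable.mul (hf.comp (by fun_prop)) (by fun_prop))
    · exact Measurable.aemeasurable
        (Measurable.mul (hf.comp (by fun_prop)) (by fun_prop))
  have hD : D = 1 := by
    have := key (f := fun _ => 1) measurable_const
    simpa using this.symm
  rw [key hf, hD, mul_one]

lemma map_gammaPi_polar (hn : 0 < n) (ha : ∀ j, 0 < a j) :
    ((gammaPi a).prod (gammaMeasure (∑ j, a j) 1)).map
      (fun p : (Fin n → ℝ) × ℝ => fun j => p.2 / (∑ i, p.1 i) * p.1 j) = gammaPi a := by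
  have hm : Measurable (fun p : (Fin n → ℝ) × ℝ => fun j => p.2 / (∑ i, p.1 i) * p.1 j) := by
    fun_prop
  refine Measure.ext_of_lintegral _ fun f hf => ?_
  rw [lintegral_map hf hm]
  exact (lintegral_prod _ (hf.comp hm).aemeasurable).trans (lintegral_gammaPi_polar hn ha hf)

/-- The self-normalised sum of squares. -/
noncomputable def selfNormalizedSq (y : Fin n → ℝ) : ℝ := (∑ j, y j ^ 2) / (∑ j, y j) ^ 2

lemma measurable_selfNormalizedSq : Measurable (selfNormalizedSq : (Fin n → ℝ) → ℝ) := by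
  unfold selfNormalizedSq
  fun_prop

/-- Cauchy–Schwarz. Keeping the statistic away from 0 bounds its negative powers, as both Fubini and
dominated convergence require. -/
lemma inv_card_le_selfNormalizedSq (hn : 0 < n) {y : Fin n → ℝ} (hy : 0 < ∑ j, y j) :
    (n : ℝ)⁻¹ ≤ selfNormalizedSq y := by
  have hn' : (0 : ℝ) < n := by exact_mod_cast hn
  rw [selfNormalizedSq, le_div_iff₀ (by positivity), inv_mul_le_iff₀ hn']
  have := sq_sum_le_card_mul_sum_sq (s := Finset.univ) (f := y)
  simpa using this

/-- The shift z - 1 cancels the factor exp(-r) of the gamma density; then r is rescaled by √v. -/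
lemma integral_gammaMeasure_exp {α v : ℝ} (hα : 0 < α) (hv : 0 < v) (z : ℂ) :
    ∫ r : ℝ, Complex.exp (-(v * (r : ℂ) ^ 2) / 2 - (z - 1) * r) ∂gammaMeasure α 1 =
      ((v ^ (-α / 2) : ℝ) : ℂ) * cylinderIntegral α (z / (√v : ℝ)) / Real.Gamma α := by
  have hs : 0 < √v := Real.sqrt_pos.2 hv
  have hs' : ((√v : ℝ) : ℂ) ≠ 0 := Complex.ofReal_ne_zero.2 hs.ne'
  rw [integral_gammaMeasure hα]
  congr 1
  have h := integral_comp_mul_left_Ioi (fun t : ℝ => ((t ^ (α - 1) : ℝ) : ℂ) *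
    Complex.exp (-(t : ℂ) ^ 2 / 2 - z / (√v : ℝ) * t)) 0 hs
  rw [mul_zero, ← cylinderIntegral, eq_inv_smul_iff₀ hs.ne'] at h
  rw [← h, Complex.real_smul, ← mul_assoc, ← Complex.ofReal_mul, ← integral_const_mul]
  refine setIntegral_congr_fun measurableSet_Ioi fun t ht => ?_
  have ht : 0 < t := ht
  have e1 : v ^ (-α / 2) * √v * (√v * t) ^ (α - 1) = t ^ (α - 1) := by
    rw [Real.mul_rpow hs.le ht.le, Real.sqrt_eq_rpow, ← Real.rpow_mul hv.le,
      ← Real.rpow_add hv, ← mul_assoc, ← Real.rpow_add hv]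
    ring_nf
    simp
  have e2 : Complex.exp (-(v * (t : ℂ) ^ 2) / 2 - (z - 1) * t) * Complex.exp (-t) =
      Complex.exp (-((√v * t : ℝ) : ℂ) ^ 2 / 2 - z / (√v : ℝ) * (√v * t : ℝ)) := by
    rw [← Complex.exp_add]
    congr 1
    have : ((√v : ℝ) : ℂ) ^ 2 = v := by rw [← Complex.ofReal_pow, Real.sq_sqrt hv.le]
    push_cast
    rw [mul_pow, this]
    field_simp
    ring
  rw [← e2, ← mul_assoc, ← Complex.ofReal_mul, e1]
  push_cast
  ring

lemma integrable_exp_gammaMeasure {a : ℝ} (ha : 0 < a) (z : ℂ) :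
    Integrable (fun r : ℝ => Complex.exp (-(r : ℂ) ^ 2 / 2 - (z - 1) * r)) (gammaMeasure a 1) := by
  have := isProbabilityMeasure_gammaMeasure ha one_pos
  refine Integrable.mono' (integrable_const (Real.exp ((z.re - 1) ^ 2)))
    (Measurable.aestronglyMeasurable (by fun_prop)) (ae_of_all _ fun r => ?_)
  rw [Complex.norm_exp]
  refine Real.exp_le_exp.2 ?_
  have : (-(r : ℂ) ^ 2 / 2) = ((-r ^ 2 / 2 : ℝ) : ℂ) := by push_cast; ring
  rw [this, Complex.sub_re, Complex.ofReal_re, Complex.re_mul_ofReal]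
  simp
  nlinarith [sq_nonneg (r + (z.re - 1)), sq_nonneg (z.re - 1)]

/-- The left side is E exp(-∑Y_j²/2 - (z-1)∑Y_j). Replacing Y by ρY/∑Y_i, with ρ an independent
gamma variable of order ∑ a_j, keeps the law and turns the exponent into -Vρ²/2 - (z-1)ρ, where V is
the self-normalised sum; then ρ is integrated out. -/
lemma prod_cylinderIntegral_eq (hn : 0 < n) (ha : ∀ j, 0 < a j) (z : ℂ) :
    ∏ j, cylinderIntegral (a j) z / Real.Gamma (a j) =
      ∫ y, ((selfNormalizedSq y ^ (-(∑ j, a j) / 2) : ℝ) : ℂ) *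
        cylinderIntegral (∑ j, a j) (z / (√(selfNormalizedSq y) : ℝ)) /
          Real.Gamma (∑ j, a j) ∂gammaPi a := by
  have hα : 0 < ∑ j, a j := Finset.sum_pos (fun j _ => ha j) ⟨⟨0, hn⟩, Finset.mem_univ _⟩
  have hp (j : Fin n) := isProbabilityMeasure_gammaMeasure (ha j) one_pos
  have hpγ := isProbabilityMeasure_gammaMeasure hα one_pos
  have hpμ := isProbabilityMeasure_gammaPi ha
  let f : (Fin n → ℝ) → ℂ := fun y =>
    ∏ j, Complex.exp (-(y j : ℂ) ^ 2 / 2 - (z - 1) * y j)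
  have hf : Measurable f := by fun_prop
  have hfi : Integrable f (gammaPi a) :=
    Integrable.fintype_prod_dep fun j => integrable_exp_gammaMeasure (ha j) z
  have hm : Measurable (fun p : (Fin n → ℝ) × ℝ => fun j => p.2 / (∑ i, p.1 i) * p.1 j) := by
    fun_prop
  have h1 : ∏ j, cylinderIntegral (a j) z / Real.Gamma (a j) = ∫ y, f y ∂gammaPi a := by
    rw [gammaPi, integral_fintype_prod_eq_prod
      (f := fun j (t : ℝ) => Complex.exp (-(t : ℂ) ^ 2 / 2 - (z - 1) * t))]
    refine Finset.prod_congr rfl fun j _ => ?_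
    have := integral_gammaMeasure_exp (ha j) one_pos z
    simpa using this.symm
  have hfi2 := hfi
  rw [← map_gammaPi_polar hn ha] at hfi2
  rw [integrable_map_measure hf.aestronglyMeasurable hm.aemeasurable] at hfi2
  rw [h1, ← map_gammaPi_polar hn ha, integral_map hm.aemeasurable hf.aestronglyMeasurable]
  rw [map_gammaPi_polar hn ha]
  refine (integral_prod _ hfi2).trans (integral_congr_ae ?_)
  filter_upwards [ae_sum_pos_gammaPi hn ha] with y hy
  have hv : 0 < selfNormalizedSq y :=
    lt_of_lt_of_le (by positivity) (inv_card_le_selfNormalizedSq hn hy)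
  rw [← integral_gammaMeasure_exp hα hv]
  congr 1
  ext r
  simp only [f, Function.comp_apply]
  rw [← Complex.exp_sum, Finset.sum_sub_distrib, ← Finset.sum_div, ← Finset.mul_sum,
    Finset.sum_neg_distrib]
  have e1 : ∑ j, ((r / (∑ i, y i) * y j : ℝ) : ℂ) ^ 2 = selfNormalizedSq y * (r : ℂ) ^ 2 := by
    have : ∑ j, (r / (∑ i, y i) * y j) ^ 2 = selfNormalizedSq y * r ^ 2 := by
      simp_rw [mul_pow]
      rw [← Finset.mul_sum, selfNormalizedSq]
      field_simp
    exact_mod_cast this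
  have e2 : ∑ j, ((r / (∑ i, y i) * y j : ℝ) : ℂ) = r := by
    have : ∑ j, (r / (∑ i, y i) * y j) = r := by
      rw [← Finset.mul_sum]
      field_simp
    exact_mod_cast this
  rw [e1, e2]

lemma finite_setOf_quadratic_eq_zero {A B C : ℝ} (h : A ≠ 0 ∨ B ≠ 0) :
    {t : ℝ | A * t ^ 2 + B * t + C = 0}.Finite := by
  let p : Polynomial ℝ :=
    Polynomial.C A * Polynomial.X ^ 2 + Polynomial.C B * Polynomial.X + Polynomial.C C
  have hp : p ≠ 0 := by
    intro h0
    have h2 : p.coeff 2 = A := by simp [p]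
    have h1 : p.coeff 1 = B := by simp [p, Polynomial.coeff_X_pow]
    rw [h0, Polynomial.coeff_zero] at h1 h2
    rcases h with h | h
    · exact h h2.symm
    · exact h h1.symm
  refine (Polynomial.finite_setOfPred_isRoot hp).subset fun t ht => ?_
  simpa [p, Polynomial.IsRoot] using ht

/-- The self-normalised sum of squares has no atoms. -/
lemma ae_selfNormalizedSq_ne (hn : 2 ≤ n) (ha : ∀ j, 0 < a j) (x : ℝ) (hx : 0 < x) :
    ∀ᵐ y ∂gammaPi a, selfNormalizedSq y ≠ x := by
  obtain ⟨m, rfl⟩ : ∃ m, n = m + 1 := ⟨n - 1, by omega⟩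
  have hp (j : Fin (m + 1)) := isProbabilityMeasure_gammaMeasure (ha j) one_pos
  let N : Set (Fin (m + 1) → ℝ) := {y | ∑ j, y j ^ 2 - x * (∑ j, y j) ^ 2 = 0}
  have hN : MeasurableSet N := measurableSet_eq_fun (by fun_prop) measurable_const
  have hmp := (measurePreserving_piFinSuccAbove (fun j => gammaMeasure (a j) 1) 0).symm
  have h0 : gammaPi a N = 0 := by
    rw [gammaPi, ← hmp.measure_preimage hN.nullMeasurableSet,
      Measure.prod_apply_symm (hmp.measurable hN), lintegral_eq_zero_iff
        (measurable_measure_prodMk_right (hmp.measurable hN))]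
    have hpos := ae_sum_pos_gammaPi (show 0 < m by omega) 
      (fun j : Fin m => ha ((0 : Fin (m + 1)).succAbove j))
    filter_upwards [hpos] with y hy
    refine gammaMeasure_absolutelyContinuous _ _ (Set.Finite.measure_zero ?_ _)
    -- With the other coordinates fixed, the equation is quadratic in the first one. It is not
    -- degenerate: when x = 1 the linear coefficient is nonzero because the remaining sum, nonempty
    -- as n ≥ 2, is positive.
    refine (finite_setOf_quadratic_eq_zero (A := 1 - x) (B := -2 * x * ∑ j, y j)
      (C := ∑ j, y j ^ 2 - x * (∑ j, y j) ^ 2) ?_).subset fun t ht => ?_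
    · by_cases hx1 : x = 1
      · right
        have := mul_pos hx hy
        nlinarith
      · left
        exact sub_ne_zero.2 (Ne.symm hx1)
    · have ht : (Fin.insertNth (α := fun _ => ℝ) 0 t y) ∈ N := ht
      simp only [N, mem_ofPred_eq, Fin.sum_univ_succ, Fin.insertNth_zero, Fin.cons_zero,
        Fin.cons_succ, cast_eq] at ht
      rw [mem_ofPred_eq, ← ht]
      ring
  have hae : ∀ᵐ y ∂gammaPi a, y ∉ N := measure_eq_zero_iff_ae_notMem.1 h0
  filter_upwards [hae, ae_sum_pos_gammaPi (by omega) ha] with y hy hS h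
  apply hy
  rw [selfNormalizedSq, div_eq_iff (by positivity)] at h
  simp only [N, mem_ofPred_eq]
  linarith

end GammaVectors

/-! ### The kernel L_b, its derivatives and its decay on rotated rays. -/

section RegularizedKernel

open Set Filter Topology

/-- `L_b(w) = exp (-w² / 2) I_b(w)`. -/
noncomputable def cylinderKernel (b : ℝ) (w : ℂ) : ℂ :=
  Complex.exp (-w ^ 2 / 2) * cylinderIntegral b w

lemma hasDerivAt_cylinderKernel {b : ℝ} (hb : 0 < b) (w : ℂ) :
    HasDerivAt (cylinderKernel b) (-(w * cylinderKernel b w + cylinderKernel (b + 1) w)) w := by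
  have h1 : HasDerivAt (fun w : ℂ => -w ^ 2 / 2) (-w) w := by
    refine ((((hasDerivAt_id w).pow 2).neg).div_const 2).congr_deriv ?_
    simp
    ring
  refine (h1.cexp.mul (hasDerivAt_cylinderIntegral hb w)).congr_deriv ?_
  simp only [cylinderKernel]
  ring

lemma cylinderKernel_add_two {b : ℝ} (hb : 0 < b) (w : ℂ) :
    cylinderKernel (b + 2) w = b * cylinderKernel b w - w * cylinderKernel (b + 1) w := by
  simp only [cylinderKernel, cylinderIntegral_add_two hb]
  ring

lemma continuous_cylinderKernel {b : ℝ} (hb : 0 < b) : Continuous (cylinderKernel b) :=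
  continuous_iff_continuousAt.2 fun w => (hasDerivAt_cylinderKernel hb w).continuousAt

lemma norm_cylinderKernel_le {b : ℝ} (hb : 0 < b) {w : ℂ} (hw : 0 ≤ w.re) :
    ‖cylinderKernel b w‖ ≤ ‖cylinderIntegral b 0‖ * Real.exp (-(w ^ 2).re / 2) := by
  rw [cylinderKernel, norm_mul, Complex.norm_exp, mul_comm]
  have : (-w ^ 2 / 2).re = -(w ^ 2).re / 2 := by
    rw [show (-w ^ 2 / 2) = (-(w ^ 2)) / ((2 : ℝ) : ℂ) by push_cast; ring, Complex.div_ofReal_re,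
      Complex.neg_re]
  rw [this]
  gcongr
  exact norm_cylinderIntegral_le hb hw

/-- The second derivative of `L_b`. -/
noncomputable def cylinderKernel₂ (b : ℝ) (w : ℂ) : ℂ :=
  (b - 1 + w ^ 2) * cylinderKernel b w + w * cylinderKernel (b + 1) w

lemma continuous_cylinderKernel₂ {b : ℝ} (hb : 0 < b) : Continuous (cylinderKernel₂ b) := by
  have h1 := continuous_cylinderKernel hb
  have h2 := continuous_cylinderKernel (show 0 < b + 1 by linarith)
  unfold cylinderKernel₂
  fun_prop

lemma norm_cylinderKernel₂_le {b : ℝ} (hb : 0 < b) {w : ℂ} (hw : 0 ≤ w.re) :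
    ‖cylinderKernel₂ b w‖ ≤ (‖(b : ℂ) - 1‖ * ‖cylinderIntegral b 0‖ + ‖cylinderIntegral b 0‖ +
      ‖cylinderIntegral (b + 1) 0‖) * (1 + ‖w‖) ^ 2 * Real.exp (-(w ^ 2).re / 2) := by
  have h1 := norm_cylinderKernel_le hb hw
  have h2 := norm_cylinderKernel_le (show 0 < b + 1 by linarith) hw
  set A := ‖cylinderIntegral b 0‖
  set B := ‖cylinderIntegral (b + 1) 0‖
  set E := Real.exp (-(w ^ 2).re / 2)
  have hA : 0 ≤ A := norm_nonneg _
  have hB : 0 ≤ B := norm_nonneg _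
  have hE : 0 ≤ E := Real.exp_nonneg _
  have hw0 : 0 ≤ ‖w‖ := norm_nonneg _
  have hq : 0 ≤ ‖(b : ℂ) - 1‖ := norm_nonneg _
  calc ‖cylinderKernel₂ b w‖
      ≤ (‖(b : ℂ) - 1‖ + ‖w‖ ^ 2) * ‖cylinderKernel b w‖ + ‖w‖ * ‖cylinderKernel (b + 1) w‖ := by
        rw [cylinderKernel₂]
        refine (norm_add_le _ _).trans ?_
        rw [norm_mul, norm_mul]
        gcongr
        refine (norm_add_le _ _).trans ?_
        rw [norm_pow]
    _ ≤ (‖(b : ℂ) - 1‖ + ‖w‖ ^ 2) * (A * E) + ‖w‖ * (B * E) := by gcongr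
    _ = ((‖(b : ℂ) - 1‖ + ‖w‖ ^ 2) * A + ‖w‖ * B) * E := by ring
    _ ≤ _ := by
      gcongr
      nlinarith [mul_nonneg hA hw0, mul_nonneg hB hw0, mul_nonneg hq hA,
        mul_nonneg (mul_nonneg hq hA) hw0, mul_nonneg (mul_nonneg hq hA) (sq_nonneg ‖w‖),
        mul_nonneg hA (sq_nonneg ‖w‖), mul_nonneg hB (sq_nonneg ‖w‖)]

/-- Polynomial growth on the half-line. -/
def PolyBoundedOn (f : ℝ → ℂ) : Prop :=
  ∃ (C : ℝ) (N : ℕ), 0 ≤ C ∧ ∀ s, 0 ≤ s → ‖f s‖ ≤ C * (1 + s) ^ N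

lemma integrableOn_one_add_pow_mul_exp {k : ℝ} (hk : 0 < k) (N : ℕ) :
    IntegrableOn (fun s : ℝ => (1 + s) ^ N * Real.exp (-k * s ^ 2)) (Ioi 0) := by
  have h0 := integrableOn_rpow_mul_exp_neg_mul_sq hk (s := 0) (by norm_num)
  have h1 := integrableOn_rpow_mul_exp_neg_mul_sq hk (s := N)
    (by have : (0 : ℝ) ≤ N := N.cast_nonneg
        linarith)
  refine ((h0.add h1).const_mul (2 ^ (N - 1))).mono' (by fun_prop) ?_
  filter_upwards [ae_restrict_mem measurableSet_Ioi] with s hs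
  have hs : 0 < s := hs
  rw [Real.norm_of_nonneg (by positivity)]
  simp only [Pi.add_apply, Real.rpow_zero, Real.rpow_natCast]
  rw [← add_mul, ← mul_assoc]
  gcongr
  simpa using add_pow_le zero_le_one hs.le N

lemma PolyBoundedOn.integrable_mul {f g : ℝ → ℂ} (hf : PolyBoundedOn f) (hfc : Continuous f)
    (hgc : Continuous g) {k K : ℝ} {N : ℕ} (hk : 0 < k)
    (hg : ∀ s, 0 ≤ s → ‖g s‖ ≤ K * (1 + s) ^ N * Real.exp (-k * s ^ 2)) :
    IntegrableOn (fun s => f s * g s) (Ioi 0) := by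
  obtain ⟨C, M, hC, hf⟩ := hf
  refine ((integrableOn_one_add_pow_mul_exp hk (M + N)).const_mul (C * K)).mono'
    (hfc.mul hgc).aestronglyMeasurable ?_
  filter_upwards [ae_restrict_mem measurableSet_Ioi] with s hs
  have hs : 0 ≤ s := le_of_lt hs
  rw [norm_mul]
  refine (mul_le_mul (hf s hs) (hg s hs) (norm_nonneg _) (by positivity)).trans_eq ?_
  rw [pow_add]
  ring

lemma polyBoundedOn_cylinderIntegral {a : ℝ} (ha : 0 < a) {c : ℂ} (hc : c ^ 2 = -Complex.I) :
    PolyBoundedOn fun s => cylinderIntegral a (c * s) := by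
  obtain ⟨C, hC, H⟩ := exists_norm_cylinderIntegral_le ha hc
  refine ⟨C, ⌈|a - 1 / 2| - 1 / 2⌉₊, hC, fun s hs => (H s hs).trans ?_⟩
  gcongr
  rw [← Real.rpow_natCast]
  exact Real.rpow_le_rpow_of_exponent_le (by linarith) (Nat.le_ceil _)

/-- The direction `exp (i (δ - π / 4))`. -/
noncomputable def rayDir (δ : ℝ) : ℂ := Complex.exp (((δ - Real.pi / 4 : ℝ) : ℂ) * Complex.I)

lemma rayDir_re (δ : ℝ) : (rayDir δ).re = Real.cos (δ - Real.pi / 4) := by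
  rw [rayDir, Complex.exp_ofReal_mul_I_re]

lemma norm_rayDir (δ : ℝ) : ‖rayDir δ‖ = 1 := Complex.norm_exp_ofReal_mul_I _

lemma rayDir_eq (δ : ℝ) : rayDir δ = rayDir 0 * Complex.exp (δ * Complex.I) := by
  rw [rayDir, rayDir, ← Complex.exp_add]
  congr 1
  push_cast
  ring

lemma rayDir_zero_sq : rayDir 0 ^ 2 = -Complex.I := by
  rw [rayDir, ← Complex.exp_nat_mul]
  have : ((2 : ℕ) : ℂ) * (((0 - Real.pi / 4 : ℝ) : ℂ) * Complex.I) =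
      -(Real.pi / 2 * Complex.I) := by
    push_cast
    ring
  rw [this, Complex.exp_neg, Complex.exp_pi_div_two_mul_I, Complex.inv_I]

/-- This governs the Gaussian decay rate of the kernel along the ray: positive for small δ > 0, zero
at δ = 0. -/
lemma rayDir_sq_re (δ : ℝ) : (rayDir δ ^ 2).re = Real.sin (2 * δ) := by
  rw [rayDir, ← Complex.exp_nat_mul]
  have : ((2 : ℕ) : ℂ) * (((δ - Real.pi / 4 : ℝ) : ℂ) * Complex.I) =
      ((2 * δ - Real.pi / 2 : ℝ) : ℂ) * Complex.I := by
    push_cast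
    ring
  rw [this, Complex.exp_ofReal_mul_I_re, Real.cos_sub_pi_div_two]

lemma continuous_rayDir : Continuous rayDir := by
  unfold rayDir
  fun_prop

lemma rayDir_re_nonneg {δ : ℝ} (h0 : 0 ≤ δ) (h1 : δ ≤ Real.pi / 4) : √2 / 2 ≤ (rayDir δ).re := by
  rw [rayDir_re, ← Real.cos_pi_div_four, ← Real.cos_neg (δ - Real.pi / 4)]
  exact Real.cos_le_cos_of_nonneg_of_le_pi (by linarith) (by linarith [Real.pi_pos]) (by linarith)

lemma sq_re_real_mul (r s : ℝ) (η : ℂ) :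
    ((r * η * s) ^ 2).re = (η ^ 2).re * r ^ 2 * s ^ 2 := by
  rw [show (r * η * s) ^ 2 = η ^ 2 * ((r ^ 2 * s ^ 2 : ℝ) : ℂ) by push_cast; ring,
    Complex.re_mul_ofReal]
  ring

lemma re_real_mul (r s : ℝ) (η : ℂ) : (r * η * s).re = r * η.re * s := by
  rw [Complex.re_mul_ofReal, Complex.re_ofReal_mul]

/-! ### The transform Φ for δ > 0 and its limit as δ → 0. -/

section Phi

variable {α δ : ℝ}

/-- The bound is uniform in r ≥ ρ, which allows the limit r → ∞ under the integral. -/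
lemma norm_kernel_ray_le {b : ℝ} (hb : 0 < b) (h0 : 0 ≤ δ) (h1 : δ ≤ Real.pi / 4) {r ρ s : ℝ}
    (hρ : 0 ≤ ρ) (hr : ρ ≤ r) (hs : 0 ≤ s) :
    ‖cylinderKernel b (r * rayDir δ * s)‖ ≤ ‖cylinderIntegral b 0‖ *
      Real.exp (-(Real.sin (2 * δ) * ρ ^ 2 / 2) * s ^ 2) := by
  have hre := rayDir_re_nonneg h0 h1
  have h2 : 0 ≤ √2 := Real.sqrt_nonneg 2
  have hr0 : 0 ≤ r := hρ.trans hr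
  refine (norm_cylinderKernel_le hb ?_).trans ?_
  · rw [re_real_mul]
    have : 0 ≤ (rayDir δ).re := by linarith
    positivity
  · gcongr
    rw [sq_re_real_mul, rayDir_sq_re]
    have hsin : 0 ≤ Real.sin (2 * δ) :=
      Real.sin_nonneg_of_nonneg_of_le_pi (by linarith) (by linarith [Real.pi_pos])
    have : ρ ^ 2 ≤ r ^ 2 := by gcongr
    have := mul_le_mul_of_nonneg_left this (mul_nonneg hsin (sq_nonneg s))
    linarith

lemma norm_kernel₂_ray_le {b : ℝ} (hb : 0 < b) (h0 : 0 ≤ δ) (h1 : δ ≤ Real.pi / 4) {r ρ R s : ℝ}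
    (hρ : 0 ≤ ρ) (hr : ρ ≤ r) (hR : r ≤ R) (hs : 0 ≤ s) :
    ‖cylinderKernel₂ b (r * rayDir δ * s)‖ ≤
      (‖(b : ℂ) - 1‖ * ‖cylinderIntegral b 0‖ + ‖cylinderIntegral b 0‖ +
      ‖cylinderIntegral (b + 1) 0‖) * (1 + R) ^ 2 * (1 + s) ^ 2 *
      Real.exp (-(Real.sin (2 * δ) * ρ ^ 2 / 2) * s ^ 2) := by
  have hre := rayDir_re_nonneg h0 h1
  have h2 : 0 ≤ √2 := Real.sqrt_nonneg 2
  have hr0 : 0 ≤ r := hρ.trans hr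
  refine (norm_cylinderKernel₂_le hb ?_).trans ?_
  · rw [re_real_mul]
    have : 0 ≤ (rayDir δ).re := by linarith
    positivity
  · have hw : ‖(r * rayDir δ * s : ℂ)‖ = r * s := by
      rw [norm_mul, norm_mul, norm_rayDir, Complex.norm_real, Complex.norm_real,
        Real.norm_of_nonneg hr0, Real.norm_of_nonneg hs, mul_one]
    have hle : (1 + r * s) ^ 2 ≤ (1 + R) ^ 2 * (1 + s) ^ 2 := by
      rw [← mul_pow]
      gcongr
      nlinarith
    have hexp : Real.exp (-((r * rayDir δ * s : ℂ) ^ 2).re / 2) ≤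
        Real.exp (-(Real.sin (2 * δ) * ρ ^ 2 / 2) * s ^ 2) := by
      gcongr
      rw [sq_re_real_mul, rayDir_sq_re]
      have hsin : 0 ≤ Real.sin (2 * δ) :=
        Real.sin_nonneg_of_nonneg_of_le_pi (by linarith) (by linarith [Real.pi_pos])
      have : ρ ^ 2 ≤ r ^ 2 := by gcongr
      have := mul_le_mul_of_nonneg_left this (mul_nonneg hsin (sq_nonneg s))
      linarith
    rw [hw, mul_assoc _ ((1 + R) ^ 2)]
    gcongr

/-- The function `f(s) = I_α(-e^{-iπ/4} s)`. -/
noncomputable def raySolution (α s : ℝ) : ℂ := cylinderIntegral α (-rayDir 0 * s)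

lemma neg_rayDir_zero_sq : (-rayDir 0) ^ 2 = -Complex.I := by rw [neg_sq, rayDir_zero_sq]

lemma continuous_raySolution (hα : 0 < α) : Continuous (raySolution α) :=
  (continuous_cylinderIntegral hα).comp (by fun_prop)

lemma polyBoundedOn_raySolution (hα : 0 < α) : PolyBoundedOn (raySolution α) :=
  polyBoundedOn_cylinderIntegral hα neg_rayDir_zero_sq

lemma hasDerivAt_raySolution (hα : 0 < α) (s : ℝ) :
    HasDerivAt (raySolution α) (rayDir 0 * raySolution (α + 1) s) s := by
  refine (hasDerivAt_cylinderIntegral_comp hα (-rayDir 0) s).congr_deriv ?_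
  rw [raySolution]
  ring

lemma PolyBoundedOn.id_mul {f : ℝ → ℂ} (hf : PolyBoundedOn f) :
    PolyBoundedOn fun s => (s : ℂ) * f s := by
  obtain ⟨C, N, hC, hf⟩ := hf
  refine ⟨C, N + 1, hC, fun s hs => ?_⟩
  rw [norm_mul, Complex.norm_real, Real.norm_of_nonneg hs, pow_succ]
  have := hf s hs
  calc s * ‖f s‖ ≤ (1 + s) * (C * (1 + s) ^ N) := by gcongr; linarith
    _ = _ := by ring

lemma integrableOn_mul_kernel {f : ℝ → ℂ} (hf : PolyBoundedOn f) (hfc : Continuous f)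
    {b : ℝ} (hb : 0 < b) (h0 : 0 < δ) (h1 : δ ≤ Real.pi / 4) {r : ℝ} (hr : 0 < r) :
    IntegrableOn (fun s : ℝ => f s * cylinderKernel b (r * rayDir δ * s)) (Ioi 0) := by
  have hsin : 0 < Real.sin (2 * δ) :=
    Real.sin_pos_of_pos_of_lt_pi (by linarith) (by linarith [Real.pi_pos])
  have hc := continuous_cylinderKernel hb
  refine hf.integrable_mul hfc (by fun_prop) (N := 0) (K := ‖cylinderIntegral b 0‖)
    (show 0 < Real.sin (2 * δ) * r ^ 2 / 2 by positivity) fun s hs => ?_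
  rw [pow_zero, mul_one]
  exact norm_kernel_ray_le hb h0.le h1 hr.le le_rfl hs

lemma integrableOn_mul_kernel₂ {f : ℝ → ℂ} (hf : PolyBoundedOn f) (hfc : Continuous f)
    {b : ℝ} (hb : 0 < b) (h0 : 0 < δ) (h1 : δ ≤ Real.pi / 4) {r : ℝ} (hr : 0 < r) :
    IntegrableOn (fun s : ℝ => f s * cylinderKernel₂ b (r * rayDir δ * s)) (Ioi 0) := by
  have hsin : 0 < Real.sin (2 * δ) :=
    Real.sin_pos_of_pos_of_lt_pi (by linarith) (by linarith [Real.pi_pos])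
  have hc := continuous_cylinderKernel₂ hb
  exact hf.integrable_mul hfc (by fun_prop)
    (show 0 < Real.sin (2 * δ) * r ^ 2 / 2 by positivity) fun s hs =>
    norm_kernel₂_ray_le hb h0.le h1 hr.le le_rfl le_rfl hs

lemma hasDerivAt_kernel_comp {b : ℝ} (hb : 0 < b) (c : ℂ) (s : ℝ) :
    HasDerivAt (fun s : ℝ => cylinderKernel b (c * s))
      (-(c * (c * s * cylinderKernel b (c * s) + cylinderKernel (b + 1) (c * s)))) s := by
  have h1 : HasDerivAt (fun s : ℝ => c * (s : ℂ)) c s := by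
    simpa using (Complex.ofRealCLM.hasDerivAt (x := s)).const_mul c
  refine ((hasDerivAt_cylinderKernel hb (c * s)).comp s h1).congr_deriv ?_
  ring

lemma one_sub_mul_exp_ne_zero {r : ℝ} (hr : 0 < r) (h0 : 0 < δ) (h1 : δ ≤ Real.pi / 4) :
    1 - (r : ℂ) * Complex.exp (δ * Complex.I) ≠ 0 ∧
      1 + (r : ℂ) * Complex.exp (δ * Complex.I) ≠ 0 := by
  have hsin : 0 < Real.sin δ :=
    Real.sin_pos_of_pos_of_lt_pi h0 (by linarith [Real.pi_pos])
  have him : ((r : ℂ) * Complex.exp (δ * Complex.I)).im = r * Real.sin δ := by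
    rw [Complex.im_ofReal_mul, Complex.exp_ofReal_mul_I_im]
  constructor <;> intro h
  · have := congrArg Complex.im h
    rw [Complex.sub_im, him] at this
    simp at this
    rcases this with h | h <;> linarith
  · have := congrArg Complex.im h
    rw [Complex.add_im, him] at this
    simp at this
    rcases this with h | h <;> linarith

/-- A Lagrange identity. The function f = `raySolution α` satisfies f'' + isf' + iαf = 0 and the
kernel satisfies L'' = (α-1)L - wL'. So fL''(cs), with c = r exp(i(δ-π/4)), is, up to the factor c²
+ i, an exact derivative, and only the value at s = 0 contributes. -/
lemma integral_raySolution_mul_kernel₂ (hα : 0 < α) (h0 : 0 < δ) (h1 : δ ≤ Real.pi / 4) {r : ℝ}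
    (hr : 0 < r) :
    ∫ s in Ioi (0 : ℝ), raySolution α s * cylinderKernel₂ α (r * rayDir δ * s) =
      -(Complex.I * rayDir 0 * (cylinderIntegral α 0 * cylinderIntegral (α + 1) 0)) /
        (1 - r * Complex.exp (δ * Complex.I)) := by
  have hα1 : 0 < α + 1 := by linarith
  set c : ℂ := r * rayDir δ with hc
  have hc2 : c = rayDir 0 * (r * Complex.exp (δ * Complex.I)) := by
    rw [hc, rayDir_eq]; ring
  have hz2 := rayDir_zero_sq
  -- With k(s) = L_α(cs), this is T = fk' - f'k - isfk.
  let T : ℝ → ℂ := fun s =>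
    raySolution α s * (-(c * (c * s * cylinderKernel α (c * s) + cylinderKernel (α + 1) (c * s))))
    - rayDir 0 * raySolution (α + 1) s * cylinderKernel α (c * s)
    - Complex.I * (s * raySolution α s) * cylinderKernel α (c * s)
  have pf := polyBoundedOn_raySolution hα
  have pf1 := polyBoundedOn_raySolution hα1
  have cf := continuous_raySolution hα
  have cf1 := continuous_raySolution hα1
  have hT (s : ℝ) : HasDerivAt T
      ((c ^ 2 + Complex.I) * (raySolution α s * cylinderKernel₂ α (c * s))) s := by
    have hs : HasDerivAt (fun s : ℝ => (s : ℂ)) 1 s := Complex.ofRealCLM.hasDerivAt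
    have hcs : HasDerivAt (fun s : ℝ => c * (s : ℂ)) c s := by simpa using hs.const_mul c
    have k0 := hasDerivAt_kernel_comp hα c s
    have k1 := hasDerivAt_kernel_comp hα1 c s
    have f0 := hasDerivAt_raySolution hα s
    have f1 := hasDerivAt_raySolution hα1 s
    have := ((f0.mul ((((hcs.mul k0).add k1).const_mul c).neg)).sub
      ((f1.const_mul (rayDir 0)).mul k0)).sub (((hs.mul f0).const_mul Complex.I).mul k0)
    refine this.congr_deriv ?_
    have hf2 : raySolution (α + 1 + 1) s =
        α * raySolution α s + rayDir 0 * s * raySolution (α + 1) s := by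
      rw [show α + 1 + 1 = α + 2 by ring, raySolution, cylinderIntegral_add_two hα]
      simp only [raySolution]
      ring
    have hk2 : cylinderKernel (α + 1 + 1) (c * s) =
        α * cylinderKernel α (c * s) - c * s * cylinderKernel (α + 1) (c * s) := by
      rw [show α + 1 + 1 = α + 2 by ring, cylinderKernel_add_two hα]
    simp only [Pi.mul_apply, Pi.neg_apply, Pi.add_apply, hf2, hk2, cylinderKernel₂]
    generalize raySolution α s = F0
    generalize raySolution (α + 1) s = F1
    generalize cylinderKernel α (c * s) = K0
    generalize cylinderKernel (α + 1) (c * s) = K1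
    linear_combination -(α * F0 * K0 + rayDir 0 * s * F1 * K0) * hz2
  have hT' := (integrableOn_mul_kernel₂ pf cf hα h0 h1 hr).const_mul (c ^ 2 + Complex.I)
  have hTi : IntegrableOn T (Ioi 0) := by
    have i1 := (integrableOn_mul_kernel pf.id_mul (by fun_prop) hα h0 h1 hr).const_mul
      (-c ^ 2 - Complex.I)
    have i2 := (integrableOn_mul_kernel pf cf hα1 h0 h1 hr).const_mul (-c)
    have i3 := (integrableOn_mul_kernel pf1 cf1 hα h0 h1 hr).const_mul (-rayDir 0)
    refine ((i1.add i2).add i3).congr (ae_of_all _ fun s => ?_)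
    simp only [T, Pi.add_apply, ← hc]
    ring
  have hlim := tendsto_zero_of_hasDerivAt_of_integrableOn_Ioi (fun s _ => hT s) hT' hTi
  have hI := integral_Ioi_of_hasDerivAt_of_tendsto' (a := 0) (fun s _ => hT s) hT' hlim
  rw [integral_const_mul] at hI
  have hT0 : T 0 = -(cylinderIntegral α 0 * cylinderIntegral (α + 1) 0) * (c + rayDir 0) := by
    simp only [T, raySolution, cylinderKernel]
    simp
    ring
  rw [hT0] at hI
  obtain ⟨hn1, hn2⟩ := one_sub_mul_exp_ne_zero hr h0 h1
  rw [hc2] at hI ⊢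
  set q : ℂ := r * Complex.exp (δ * Complex.I)
  rw [eq_div_iff hn1, ← mul_left_inj' (mul_ne_zero hn2 Complex.I_ne_zero)]
  -- The factor 1 + q also divides T(0), so only the pole at q = 1 survives.
  have e1 : (rayDir 0 * q) ^ 2 + Complex.I = (1 - q) * (1 + q) * Complex.I := by
    linear_combination q ^ 2 * hz2
  rw [e1] at hI
  linear_combination hI + rayDir 0 * (cylinderIntegral α 0 * cylinderIntegral (α + 1) 0) *
    (1 + q) * Complex.I_sq

/-- `Φ(r) = ∫₀^∞ f(s) r^{1-α} L_α(r η s) ds` with `η = exp (i (δ - π / 4))`. -/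
noncomputable def rayTransform (α δ r : ℝ) : ℂ :=
  ∫ s in Ioi (0 : ℝ), raySolution α s *
    (((r ^ (1 - α) : ℝ) : ℂ) * cylinderKernel α (r * rayDir δ * s))

/-- The power r^(1-α) is chosen so that, by L'' = (α-1)L - wL', the r-derivative is a multiple of
L'' alone, whose integral against f is explicit. -/
lemma hasDerivAt_rpow_mul_kernel (hα : 0 < α) (η : ℂ) (s : ℝ) {r : ℝ} (hr : 0 < r) :
    HasDerivAt (fun r : ℝ => ((r ^ (1 - α) : ℝ) : ℂ) * cylinderKernel α (r * η * s))
      (-(((r ^ (-α) : ℝ) : ℂ) * cylinderKernel₂ α (r * η * s))) r := by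
  have h1 : HasDerivAt (fun r : ℝ => ((r ^ (1 - α) : ℝ) : ℂ))
      (((1 - α) * r ^ (-α) : ℝ) : ℂ) r := by
    have := (Real.hasDerivAt_rpow_const (p := 1 - α) (Or.inl hr.ne')).ofReal_comp
    rwa [show 1 - α - 1 = -α by ring] at this
  have h2 := hasDerivAt_kernel_comp hα (η * s) r
  have h3 : (fun r : ℝ => cylinderKernel α (r * η * s)) =
      fun r : ℝ => cylinderKernel α (η * s * r) := by
    ext r; congr 1; ring
  rw [← h3] at h2
  refine (h1.mul h2).congr_deriv ?_
  rw [show (η * s * r : ℂ) = r * η * s by ring]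
  have e : r ^ (1 - α) = r * r ^ (-α) := by
    rw [sub_eq_add_neg, Real.rpow_add hr, Real.rpow_one]
  rw [e, cylinderKernel₂]
  push_cast
  ring

lemma hasDerivAt_rayTransform (hα : 0 < α) (h0 : 0 < δ) (h1 : δ ≤ Real.pi / 4) {r : ℝ}
    (hr : 0 < r) :
    HasDerivAt (rayTransform α δ)
      (Complex.I * rayDir 0 * (cylinderIntegral α 0 * cylinderIntegral (α + 1) 0) *
        ((r ^ (-α) : ℝ) : ℂ) / (1 - r * Complex.exp (δ * Complex.I))) r := by
  have hsin : 0 < Real.sin (2 * δ) :=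
    Real.sin_pos_of_pos_of_lt_pi (by linarith) (by linarith [Real.pi_pos])
  have pf := polyBoundedOn_raySolution hα
  have cf := continuous_raySolution hα
  have ck := continuous_cylinderKernel hα
  have ck2 := continuous_cylinderKernel₂ hα
  obtain ⟨C, N, hC, hf⟩ := pf
  set K : ℝ := (‖(α : ℂ) - 1‖ * ‖cylinderIntegral α 0‖ + ‖cylinderIntegral α 0‖ +
      ‖cylinderIntegral (α + 1) 0‖) * (1 + 2 * r) ^ 2 with hK
  have hpos : 0 < Real.sin (2 * δ) * (r / 2) ^ 2 / 2 := by positivity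
  have key := hasDerivAt_integral_of_dominated_loc_of_deriv_le (𝕜 := ℝ)
    (μ := volume.restrict (Ioi (0 : ℝ)))
    (F := fun r s => raySolution α s *
      (((r ^ (1 - α) : ℝ) : ℂ) * cylinderKernel α (r * rayDir δ * s)))
    (F' := fun r s => raySolution α s *
      (-(((r ^ (-α) : ℝ) : ℂ) * cylinderKernel₂ α (r * rayDir δ * s))))
    (bound := fun s => (C * (r / 2) ^ (-α) * K) * ((1 + s) ^ (N + 2) *
      Real.exp (-(Real.sin (2 * δ) * (r / 2) ^ 2 / 2) * s ^ 2)))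
    (x₀ := r) (s := Ioo (r / 2) (2 * r)) (Ioo_mem_nhds (by linarith) (by linarith))
    (Eventually.of_forall fun u => Continuous.aestronglyMeasurable (by fun_prop))
    ?_ (Continuous.aestronglyMeasurable (by fun_prop)) ?_
    ((integrableOn_one_add_pow_mul_exp hpos (N + 2)).const_mul _) ?_
  · have h := key.2
    refine h.congr_deriv ?_
    have e (s : ℝ) : raySolution α s *
        (-(((r ^ (-α) : ℝ) : ℂ) * cylinderKernel₂ α (r * rayDir δ * s))) =
        -((r ^ (-α) : ℝ) : ℂ) * (raySolution α s * cylinderKernel₂ α (r * rayDir δ * s)) := by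
      ring
    simp_rw [e]
    rw [integral_const_mul, integral_raySolution_mul_kernel₂ hα h0 h1 hr]
    ring
  · have := (integrableOn_mul_kernel (polyBoundedOn_raySolution hα) cf hα h0 h1 hr).const_mul
      ((r ^ (1 - α) : ℝ) : ℂ)
    refine this.congr (ae_of_all _ fun s => ?_)
    simp only
    ring
  · filter_upwards [ae_restrict_mem measurableSet_Ioi] with s hs u hu
    have hs : 0 ≤ s := le_of_lt hs
    have hu0 : 0 < u := lt_trans (by linarith) hu.1
    have b1 := hf s hs
    have b2 := norm_kernel₂_ray_le hα h0.le h1 (ρ := r / 2) (by linarith) hu.1.le hu.2.le hs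
    have b3 : u ^ (-α) ≤ (r / 2) ^ (-α) :=
      Real.rpow_le_rpow_of_nonpos (by linarith) hu.1.le (by linarith)
    rw [norm_mul, norm_neg, norm_mul, Complex.norm_real, Real.norm_of_nonneg (by positivity)]
    calc _ ≤ (C * (1 + s) ^ N) * ((r / 2) ^ (-α) * (K * (1 + s) ^ 2 *
            Real.exp (-(Real.sin (2 * δ) * (r / 2) ^ 2 / 2) * s ^ 2))) := by gcongr
      _ = _ := by ring
  · filter_upwards with s u hu
    have hu0 : 0 < u := lt_trans (by linarith) hu.1
    exact (hasDerivAt_rpow_mul_kernel hα (rayDir δ) s hu0).const_mul _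

/-- For r ≥ 1 the integral is bounded, so the factor r^(1-α) tends to zero and carries the transform
with it; this is where α > 1 enters. -/
lemma tendsto_rayTransform_atTop (hα : 1 < α) (h0 : 0 < δ) (h1 : δ ≤ Real.pi / 4) :
    Tendsto (rayTransform α δ) atTop (𝓝 0) := by
  have hα0 : 0 < α := by linarith
  have hsin : 0 < Real.sin (2 * δ) :=
    Real.sin_pos_of_pos_of_lt_pi (by linarith) (by linarith [Real.pi_pos])
  obtain ⟨C, N, hC, hf⟩ := polyBoundedOn_raySolution hα0
  have hpos : 0 < Real.sin (2 * δ) * 1 ^ 2 / 2 := by positivity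
  have hint := (integrableOn_one_add_pow_mul_exp hpos N).const_mul (C * ‖cylinderIntegral α 0‖)
  set J := ∫ s in Ioi (0 : ℝ), C * ‖cylinderIntegral α 0‖ * ((1 + s) ^ N *
    Real.exp (-(Real.sin (2 * δ) * 1 ^ 2 / 2) * s ^ 2)) with hJ
  have hlim : Tendsto (fun r : ℝ => r ^ (-(α - 1)) * J) atTop (𝓝 0) := by
    have := (tendsto_rpow_neg_atTop (show 0 < α - 1 by linarith)).mul_const J
    simpa using this
  refine squeeze_zero_norm' ?_ hlim
  filter_upwards [eventually_ge_atTop 1] with r hr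
  have hr0 : 0 < r := by linarith
  rw [rayTransform, hJ, ← integral_const_mul]
  refine norm_integral_le_of_norm_le (hint.const_mul _) ?_
  filter_upwards [ae_restrict_mem measurableSet_Ioi] with s hs
  have hs : 0 ≤ s := le_of_lt hs
  have b1 := hf s hs
  have b2 := norm_kernel_ray_le hα0 h0.le h1 zero_le_one hr hs
  rw [norm_mul, norm_mul, Complex.norm_real, Real.norm_of_nonneg (by positivity), neg_sub]
  calc _ ≤ (C * (1 + s) ^ N) * (r ^ (1 - α) * (‖cylinderIntegral α 0‖ *
      Real.exp (-(Real.sin (2 * δ) * 1 ^ 2 / 2) * s ^ 2))) := by gcongr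
    _ = _ := by ring

lemma re_I_mul_inv_one_sub (r δ : ℝ) :
    (Complex.I / (1 - r * Complex.exp (δ * Complex.I))).re =
      -(r * Real.sin δ / ((r - Real.cos δ) ^ 2 + Real.sin δ ^ 2)) := by
  have hre : (1 - r * Complex.exp (δ * Complex.I) : ℂ).re = 1 - r * Real.cos δ := by
    rw [Complex.sub_re, Complex.re_ofReal_mul, Complex.exp_ofReal_mul_I_re, Complex.one_re]
  have him : (1 - r * Complex.exp (δ * Complex.I) : ℂ).im = -(r * Real.sin δ) := by
    rw [Complex.sub_im, Complex.im_ofReal_mul, Complex.exp_ofReal_mul_I_im, Complex.one_im]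
    ring
  have hn : Complex.normSq (1 - r * Complex.exp (δ * Complex.I)) =
      (r - Real.cos δ) ^ 2 + Real.sin δ ^ 2 := by
    rw [Complex.normSq_apply, hre, him]
    have := Real.sin_sq_add_cos_sq δ
    linear_combination (r ^ 2 - 1) * this
  rw [Complex.div_re, hre, him, hn]
  simp
  ring

lemma re_rayTransform_eq (hα : 1 < α) (h0 : 0 < δ) (h1 : δ ≤ Real.pi / 4) {r : ℝ} (hr : 0 < r) :
    ((rayDir 0)⁻¹ * rayTransform α δ r).re =
      (cylinderIntegral α 0 * cylinderIntegral (α + 1) 0).re *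
        ∫ u in Ioi r, u ^ (1 - α) * Real.sin δ / ((u - Real.cos δ) ^ 2 + Real.sin δ ^ 2) := by
  have hα0 : 0 < α := by linarith
  have hsin : 0 < Real.sin δ :=
    Real.sin_pos_of_pos_of_lt_pi h0 (by linarith [Real.pi_pos])
  have hζ : rayDir 0 ≠ 0 := Complex.exp_ne_zero _
  obtain ⟨c, hc0, hc⟩ : ∃ c : ℝ, 0 ≤ c ∧
      cylinderIntegral α 0 * cylinderIntegral (α + 1) 0 = (c : ℂ) := by
    rw [cylinderIntegral_zero hα0, cylinderIntegral_zero (by linarith), ← Complex.ofReal_mul]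
    have g1 := Real.Gamma_pos_of_pos (show 0 < α / 2 by linarith)
    have g2 := Real.Gamma_pos_of_pos (show 0 < (α + 1) / 2 by linarith)
    exact ⟨_, by positivity, rfl⟩
  have hd : ∀ u ∈ Ici r, HasDerivAt (fun u => ((rayDir 0)⁻¹ * rayTransform α δ u).re)
      (-(c * (u ^ (1 - α) * Real.sin δ / ((u - Real.cos δ) ^ 2 + Real.sin δ ^ 2)))) u := by
    intro u hu
    have hu0 : 0 < u := lt_of_lt_of_le hr hu
    have h := (hasDerivAt_rayTransform hα0 h0 h1 hu0).const_mul (rayDir 0)⁻¹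
    refine (Complex.reCLM.hasFDerivAt.comp_hasDerivAt u h).congr_deriv ?_
    have e1 : (rayDir 0)⁻¹ * (Complex.I * rayDir 0 *
        (cylinderIntegral α 0 * cylinderIntegral (α + 1) 0) * ((u ^ (-α) : ℝ) : ℂ) /
          (1 - u * Complex.exp (δ * Complex.I))) =
        ((c * u ^ (-α) : ℝ) : ℂ) * (Complex.I / (1 - u * Complex.exp (δ * Complex.I))) := by
      rw [hc]
      push_cast
      field_simp
    have e2 : u ^ (1 - α) = u * u ^ (-α) := by
      rw [sub_eq_add_neg, Real.rpow_add hu0, Real.rpow_one]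
    rw [e1, Complex.reCLM_apply, Complex.re_ofReal_mul, re_I_mul_inv_one_sub, e2]
    ring
  have hlim : Tendsto (fun u => ((rayDir 0)⁻¹ * rayTransform α δ u).re) atTop (𝓝 0) := by
    have := (Complex.continuous_re.tendsto _).comp
      ((tendsto_rayTransform_atTop hα h0 h1).const_mul (rayDir 0)⁻¹)
    rwa [mul_zero, Complex.zero_re] at this
  -- The sign of the derivative makes a separate integrability proof unnecessary.
  have hI := integral_Ioi_of_hasDerivAt_of_nonpos' hd (fun u hu => ?_) hlim
  · rw [integral_neg, integral_const_mul] at hI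
    rw [hc, Complex.ofReal_re]
    linarith
  · have hu0 : 0 < u := lt_trans hr hu
    rw [Left.neg_nonpos_iff]
    positivity

/-- The substitution u = y sin δ + cos δ moves δ from the Cauchy density into the argument of
u^(1-α), so that dominated convergence applies as δ → 0. -/
lemma integral_cauchy_eq (hsin : 0 < Real.sin δ) (r : ℝ) :
    ∫ u in Ioi r, u ^ (1 - α) * Real.sin δ / ((u - Real.cos δ) ^ 2 + Real.sin δ ^ 2) =
      ∫ y : ℝ, (Ioi r).indicator (fun u => u ^ (1 - α)) (Real.sin δ * y + Real.cos δ) *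
        (1 + y ^ 2)⁻¹ := by
  rw [← integral_indicator measurableSet_Ioi]
  set g : ℝ → ℝ := (Ioi r).indicator fun u =>
    u ^ (1 - α) * Real.sin δ / ((u - Real.cos δ) ^ 2 + Real.sin δ ^ 2) with hg
  have h1 : ∫ u, g u = ∫ u, g (u + Real.cos δ) := (integral_add_right_eq_self g _).symm
  have h2 := Measure.integral_comp_mul_left (fun u => g (u + Real.cos δ)) (Real.sin δ)
  rw [abs_of_pos (inv_pos.2 hsin), eq_inv_smul_iff₀ hsin.ne', smul_eq_mul,
    ← integral_const_mul] at h2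
  rw [h1, ← h2]
  congr 1
  ext y
  simp only [hg, indicator_apply]
  split_ifs
  · rw [add_sub_cancel_right]
    field_simp
    ring
  · simp

lemma norm_cauchy_integrand_le (hα : 1 < α) {r : ℝ} (hr : 0 < r) (x y : ℝ) :
    ‖(Ioi r).indicator (fun u => u ^ (1 - α)) x * (1 + y ^ 2)⁻¹‖ ≤
      r ^ (1 - α) * (1 + y ^ 2)⁻¹ := by
  rw [norm_mul, Real.norm_of_nonneg (show 0 ≤ (1 + y ^ 2)⁻¹ by positivity)]
  gcongr
  rw [indicator_apply]
  split_ifs with h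
  · have hx : 0 < x := lt_trans hr h
    rw [Real.norm_of_nonneg (by positivity)]
    exact Real.rpow_le_rpow_of_nonpos hr (le_of_lt h) (by linarith)
  · simp
    positivity

/-- Independent of δ: this is the majorant for passing to the limit under the expectation. -/
lemma abs_re_rayTransform_le (hα : 1 < α) (h0 : 0 < δ) (h1 : δ ≤ Real.pi / 4) {r : ℝ}
    (hr : 0 < r) :
    |((rayDir 0)⁻¹ * rayTransform α δ r).re| ≤
      |(cylinderIntegral α 0 * cylinderIntegral (α + 1) 0).re| * (r ^ (1 - α) * Real.pi) := by
  have hsin : 0 < Real.sin δ :=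
    Real.sin_pos_of_pos_of_lt_pi h0 (by linarith [Real.pi_pos])
  rw [re_rayTransform_eq hα h0 h1 hr, abs_mul, integral_cauchy_eq hsin]
  gcongr
  rw [← integral_univ_inv_one_add_sq, ← integral_const_mul, ← Real.norm_eq_abs]
  exact norm_integral_le_of_norm_le (integrable_inv_one_add_sq.const_mul _)
    (ae_of_all _ fun y => norm_cauchy_integrand_le hα hr _ y)

/-- For each y the argument y sin δ + cos δ tends to 1, where the truncated power u^(1-α) on u > r
is continuous unless r = 1. -/
lemma tendsto_re_rayTransform (hα : 1 < α) {r : ℝ} (hr : 0 < r) (hr1 : r ≠ 1) :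
    Tendsto (fun δ => ((rayDir 0)⁻¹ * rayTransform α δ r).re) (𝓝[>] 0)
      (𝓝 ((cylinderIntegral α 0 * cylinderIntegral (α + 1) 0).re *
        (Real.pi * (Iio 1).indicator 1 r))) := by
  have hev : ∀ᶠ δ : ℝ in 𝓝[>] 0, 0 < δ ∧ δ ≤ Real.pi / 4 := by
    filter_upwards [Ioc_mem_nhdsGT (show (0 : ℝ) < Real.pi / 4 by positivity)] with δ hδ
    exact hδ
  have heq : (fun δ => (cylinderIntegral α 0 * cylinderIntegral (α + 1) 0).re *
      ∫ y : ℝ, (Ioi r).indicator (fun u => u ^ (1 - α)) (Real.sin δ * y + Real.cos δ) *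
        (1 + y ^ 2)⁻¹) =ᶠ[𝓝[>] 0] fun δ => ((rayDir 0)⁻¹ * rayTransform α δ r).re := by
    filter_upwards [hev] with δ hδ
    have hsin : 0 < Real.sin δ :=
      Real.sin_pos_of_pos_of_lt_pi hδ.1 (by linarith [Real.pi_pos, hδ.2])
    rw [re_rayTransform_eq hα hδ.1 hδ.2 hr, integral_cauchy_eq hsin]
  refine Tendsto.congr' heq (Tendsto.const_mul _ ?_)
  have hπ : Real.pi * (Iio 1).indicator 1 r =
      ∫ y : ℝ, (Iio (1 : ℝ)).indicator 1 r * (1 + y ^ 2)⁻¹ := by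
    rw [integral_const_mul, integral_univ_inv_one_add_sq, mul_comm]
  rw [hπ]
  refine tendsto_integral_filter_of_dominated_convergence (fun y => r ^ (1 - α) * (1 + y ^ 2)⁻¹)
    (Eventually.of_forall fun δ => ?_)
    (Eventually.of_forall fun δ => ae_of_all _ fun y => norm_cauchy_integrand_le hα hr _ y)
    (integrable_inv_one_add_sq.const_mul _) (ae_of_all _ fun y => ?_)
  · have h1 : Measurable ((Ioi r).indicator (fun u : ℝ => u ^ (1 - α))) :=
      Measurable.indicator (by fun_prop) measurableSet_Ioi
    exact (Measurable.mul (h1.comp (by fun_prop)) (by fun_prop)).aestronglyMeasurable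
  · refine Tendsto.mul_const _ ?_
    have hx : Tendsto (fun δ => Real.sin δ * y + Real.cos δ) (𝓝[>] 0) (𝓝 1) := by
      have : Continuous fun δ => Real.sin δ * y + Real.cos δ := by fun_prop
      have := (this.tendsto 0).mono_left (nhdsWithin_le_nhds (s := Ioi 0))
      simpa using this
    rcases lt_or_gt_of_ne hr1 with h | h
    · rw [indicator_of_mem (show r ∈ Iio (1 : ℝ) from h)]
      have h2 : Tendsto (fun δ => (Real.sin δ * y + Real.cos δ) ^ (1 - α)) (𝓝[>] 0) (𝓝 1) := by
        have := hx.rpow_const (p := 1 - α) (Or.inl one_ne_zero)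
        simpa using this
      refine Tendsto.congr' ?_ h2
      filter_upwards [hx.eventually (lt_mem_nhds h)] with δ hδ
      rw [indicator_of_mem (show _ ∈ Ioi r from hδ)]
    · rw [indicator_of_notMem (show r ∉ Iio (1 : ℝ) from not_lt.2 h.le)]
      refine Tendsto.congr' ?_ tendsto_const_nhds
      filter_upwards [hx.eventually (gt_mem_nhds h)] with δ hδ
      rw [indicator_of_notMem (show _ ∉ Ioi r from not_lt.2 (le_of_lt hδ))]

end Phi

end RegularizedKernel

/-! ### Fubini, the limit δ → 0 on both sides, and the constants. -/

section Assembly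

open Set Filter Topology

variable {n : ℕ} {a : Fin n → ℝ}

/-- Replacing s by s√v merges v^(-α/2), the Jacobian √v and κ^(1-α) into (κ√v)^(1-α), so κ and v
enter only through κ√v. -/
lemma integral_raySolution_comp_div {α δ κ v : ℝ} (hκ : 0 < κ) (hv : 0 < v) :
    ∫ s in Ioi (0 : ℝ), ((v ^ (-α / 2) : ℝ) : ℂ) * raySolution α (s / √v) *
        (((κ ^ (1 - α) : ℝ) : ℂ) * cylinderKernel α (κ * rayDir δ * s)) =
      rayTransform α δ (κ * √v) := by
  have hs : 0 < √v := Real.sqrt_pos.2 hv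
  have h := integral_comp_mul_left_Ioi (fun s : ℝ => ((v ^ (-α / 2) : ℝ) : ℂ) *
    raySolution α (s / √v) * (((κ ^ (1 - α) : ℝ) : ℂ) * cylinderKernel α (κ * rayDir δ * s))) 0 hs
  rw [mul_zero, eq_inv_smul_iff₀ hs.ne', Complex.real_smul, ← integral_const_mul] at h
  rw [← h, rayTransform]
  refine setIntegral_congr_fun measurableSet_Ioi fun s _ => ?_
  have e : √v * v ^ (-α / 2) * κ ^ (1 - α) = (κ * √v) ^ (1 - α) := by
    rw [Real.mul_rpow hκ.le hs.le, Real.sqrt_eq_rpow, ← Real.rpow_mul hv.le, ← Real.rpow_add hv]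
    ring_nf
  rw [mul_div_cancel_left₀ _ hs.ne', ← e]
  push_cast
  rw [show (κ * rayDir δ * (((√v : ℝ) : ℂ) * s)) = κ * ((√v : ℝ) : ℂ) * rayDir δ * s by ring]
  ring

/-- The product of the normalised solutions `I_{a_j} / Γ(a_j)` along the ray. -/
noncomputable def rayProduct (a : Fin n → ℝ) (s : ℝ) : ℂ :=
  ∏ j, raySolution (a j) s / Real.Gamma (a j)

lemma continuous_rayProduct (ha : ∀ j, 0 < a j) : Continuous (rayProduct a) := by
  have (j : Fin n) := continuous_raySolution (ha j)
  unfold rayProduct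
  fun_prop

lemma raySolution_div (α s c : ℝ) :
    raySolution α (s / c) = cylinderIntegral α (-rayDir 0 * s / c) := by
  rw [raySolution, Complex.ofReal_div, mul_div_assoc]

lemma rayProduct_eq (hn : 0 < n) (ha : ∀ j, 0 < a j) (s : ℝ) :
    rayProduct a s = ∫ y, ((selfNormalizedSq y ^ (-(∑ j, a j) / 2) : ℝ) : ℂ) *
        raySolution (∑ j, a j) (s / √(selfNormalizedSq y)) /
          Real.Gamma (∑ j, a j) ∂gammaPi a := by
  simp_rw [raySolution_div]
  exact prod_cylinderIntegral_eq hn ha _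

lemma exists_norm_rayProduct_le (hn : 2 ≤ n) (ha : ∀ j, 0 < a j) (hsum : 1 < ∑ j, a j) :
    ∃ C β : ℝ, 0 ≤ C ∧ 1 < β ∧ ∀ s : ℝ, 0 ≤ s →
      ‖rayProduct a s‖ ≤ C * (1 + s) ^ (∑ j, a j - β) := by
  obtain ⟨C, β, hC, hβ, H⟩ := exists_norm_prod_cylinderIntegral_le hn ha hsum neg_rayDir_zero_sq
  refine ⟨C / ‖∏ j, (Real.Gamma (a j) : ℂ)‖, β, by positivity, hβ, fun s hs => ?_⟩
  rw [rayProduct, Finset.prod_div_distrib, norm_div, div_mul_eq_mul_div]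
  gcongr
  exact H s hs

/-- The constant must not depend on δ, and δ = 0 is included. The Gaussian factor is therefore only
bounded by 1, and the decay comes from I_α, the real part of the argument being at least κs√2/2. -/
lemma exists_norm_kernel_ray_le {α κ : ℝ} (hα : 0 < α) (hκ : 0 < κ) :
    ∃ C, 0 ≤ C ∧ ∀ δ s : ℝ, 0 ≤ δ → δ ≤ Real.pi / 4 → 0 ≤ s →
      ‖cylinderKernel α (κ * rayDir δ * s)‖ ≤ C * (1 + s) ^ (-α) := by
  set k : ℝ := κ * (√2 / 2) with hk
  have hk0 : 0 < k := by positivity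
  have hΓ := Real.Gamma_pos_of_pos hα
  refine ⟨‖cylinderIntegral α 0‖ * 2 ^ α + Real.Gamma α * k ^ (-α) * 2 ^ α, by positivity,
    fun δ s h0 h1 hs => ?_⟩
  have hre := rayDir_re_nonneg h0 h1
  have hw : k * s ≤ (κ * rayDir δ * s : ℂ).re := by
    rw [re_real_mul, hk]
    gcongr
  have hw0 : 0 ≤ (κ * rayDir δ * s : ℂ).re := le_trans (by positivity) hw
  have hle : ‖cylinderKernel α (κ * rayDir δ * s)‖ ≤ ‖cylinderIntegral α (κ * rayDir δ * s)‖ := by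
    rw [cylinderKernel, norm_mul, Complex.norm_exp]
    refine mul_le_of_le_one_left (norm_nonneg _) (Real.exp_le_one_iff.2 ?_)
    have hsin : 0 ≤ Real.sin (2 * δ) :=
      Real.sin_nonneg_of_nonneg_of_le_pi (by linarith) (by linarith [Real.pi_pos])
    rw [show (-(κ * rayDir δ * s : ℂ) ^ 2 / 2) =
      (-((κ * rayDir δ * s : ℂ) ^ 2)) / ((2 : ℝ) : ℂ) by push_cast; ring, Complex.div_ofReal_re,
      Complex.neg_re, sq_re_real_mul, rayDir_sq_re]
    have : 0 ≤ Real.sin (2 * δ) * κ ^ 2 * s ^ 2 := by positivity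
    linarith
  refine hle.trans ?_
  rw [add_mul]
  rcases le_total s 1 with h | h
  · refine le_trans ((norm_cylinderIntegral_le hα hw0).trans ?_)
      (le_add_of_nonneg_right (by positivity))
    have h3 : (2 : ℝ) ^ (-α) ≤ (1 + s) ^ (-α) :=
      Real.rpow_le_rpow_of_nonpos (by linarith) (by linarith) (by linarith)
    rw [mul_assoc]
    refine le_mul_of_one_le_right (norm_nonneg _) ?_
    calc (1 : ℝ) = 2 ^ α * 2 ^ (-α) := by rw [← Real.rpow_add (by norm_num)]; simp
      _ ≤ _ := by gcongr
  · refine le_trans ?_ (le_add_of_nonneg_left (by positivity))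
    have hks : 0 < k * s := by positivity
    refine (norm_cylinderIntegral_le_rpow hα (lt_of_lt_of_le hks hw)).trans ?_
    have h3 := rpow_le_two_rpow_abs_mul h (-α)
    rw [abs_neg, abs_of_pos hα] at h3
    calc _ ≤ Real.Gamma α * (k * s) ^ (-α) := by
          exact mul_le_mul_of_nonneg_left
            (Real.rpow_le_rpow_of_nonpos hks hw (neg_nonpos.2 hα.le)) hΓ.le
      _ = Real.Gamma α * k ^ (-α) * s ^ (-α) := by
          rw [Real.mul_rpow hk0.le (by linarith)]; ring
      _ ≤ Real.Gamma α * k ^ (-α) * (2 ^ α * (1 + s) ^ (-α)) := by gcongr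
      _ = _ := by ring

lemma integrableOn_one_add_rpow_neg {β : ℝ} (hβ : 1 < β) :
    IntegrableOn (fun s : ℝ => (1 + s) ^ (-β)) (Ioi 0) := by
  have h := integrable_one_add_norm (E := ℝ) (μ := volume) (r := β) (by simpa using hβ)
  refine (h.integrableOn (s := Ioi 0)).congr_fun (fun s hs => ?_) measurableSet_Ioi
  simp only
  rw [Real.norm_of_nonneg (le_of_lt hs)]

/-- A common integrable majorant of the product with the rotated kernels. -/
lemma exists_integrable_bound (hn : 2 ≤ n) (ha : ∀ j, 0 < a j) (hsum : 1 < ∑ j, a j) {κ : ℝ}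
    (hκ : 0 < κ) :
    ∃ bound : ℝ → ℝ, IntegrableOn bound (Ioi 0) ∧ ∀ δ s : ℝ, 0 ≤ δ → δ ≤ Real.pi / 4 → 0 ≤ s →
      ‖rayProduct a s * cylinderKernel (∑ j, a j) (κ * rayDir δ * s)‖ ≤ bound s := by
  obtain ⟨C, β, hC, hβ, H⟩ := exists_norm_rayProduct_le hn ha hsum
  obtain ⟨D, hD, H'⟩ := exists_norm_kernel_ray_le (show 0 < ∑ j, a j by linarith) hκ
  refine ⟨fun s => C * D * (1 + s) ^ (-β), (integrableOn_one_add_rpow_neg hβ).const_mul _,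
    fun δ s h0 h1 hs => ?_⟩
  rw [norm_mul]
  refine (mul_le_mul (H s hs) (H' δ s h0 h1 hs) (norm_nonneg _) (by positivity)).trans_eq ?_
  simp only
  rw [show -β = (∑ j, a j - β) + -∑ j, a j by ring, Real.rpow_add (by linarith)]
  ring

lemma integrableOn_rayProduct_mul_kernel (hn : 2 ≤ n) (ha : ∀ j, 0 < a j) (hsum : 1 < ∑ j, a j)
    {κ δ : ℝ} (hκ : 0 < κ) (h0 : 0 ≤ δ) (h1 : δ ≤ Real.pi / 4) :
    IntegrableOn (fun s : ℝ => rayProduct a s *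
      cylinderKernel (∑ j, a j) (κ * rayDir δ * s)) (Ioi 0) := by
  obtain ⟨bound, hb, H⟩ := exists_integrable_bound hn ha hsum hκ
  have c1 := continuous_rayProduct ha
  have c2 := continuous_cylinderKernel (show 0 < ∑ j, a j by linarith)
  refine hb.mono' (Continuous.aestronglyMeasurable (by fun_prop)) ?_
  filter_upwards [ae_restrict_mem measurableSet_Ioi] with s hs
  exact H δ s h0 h1 (le_of_lt hs)

lemma tendsto_integral_rayProduct_mul_kernel (hn : 2 ≤ n) (ha : ∀ j, 0 < a j)
    (hsum : 1 < ∑ j, a j) {κ : ℝ} (hκ : 0 < κ) :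
    Tendsto (fun δ => ∫ s in Ioi (0 : ℝ), rayProduct a s *
        cylinderKernel (∑ j, a j) (κ * rayDir δ * s)) (𝓝[>] 0)
      (𝓝 (∫ s in Ioi (0 : ℝ), rayProduct a s *
        cylinderKernel (∑ j, a j) (κ * rayDir 0 * s))) := by
  obtain ⟨bound, hb, H⟩ := exists_integrable_bound hn ha hsum hκ
  have c1 := continuous_rayProduct ha
  have c2 := continuous_cylinderKernel (show 0 < ∑ j, a j by linarith)
  have c3 := continuous_rayDir
  refine tendsto_integral_filter_of_dominated_convergence bound
    (Eventually.of_forall fun δ => Continuous.aestronglyMeasurable (by fun_prop)) ?_ hb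
    (ae_of_all _ fun s => ?_)
  · filter_upwards [Ioc_mem_nhdsGT (show (0 : ℝ) < Real.pi / 4 by positivity)] with δ hδ
    filter_upwards [ae_restrict_mem measurableSet_Ioi] with s hs
    exact H δ s hδ.1.le hδ.2 (le_of_lt hs)
  · have : Continuous fun δ => rayProduct a s *
        cylinderKernel (∑ j, a j) (κ * rayDir δ * s) := by fun_prop
    exact (this.tendsto 0).mono_left nhdsWithin_le_nhds

/-- The hypothesis for Fubini. For δ > 0 the Gaussian decay beats the polynomial growth of f, and V
≥ 1/n makes the bound uniform in y. -/
lemma integrable_prod_raySolution_mul_kernel (hn : 0 < n) (ha : ∀ j, 0 < a j) {κ δ : ℝ}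
    (hκ : 0 < κ) (h0 : 0 < δ) (h1 : δ ≤ Real.pi / 4) :
    Integrable (fun p : ℝ × (Fin n → ℝ) =>
      ((selfNormalizedSq p.2 ^ (-(∑ j, a j) / 2) : ℝ) : ℂ) *
        raySolution (∑ j, a j) (p.1 / √(selfNormalizedSq p.2)) *
        (((κ ^ (1 - ∑ j, a j) : ℝ) : ℂ) * cylinderKernel (∑ j, a j) (κ * rayDir δ * p.1)))
      ((volume.restrict (Ioi 0)).prod (gammaPi a)) := by
  have hα : 0 < ∑ j, a j := Finset.sum_pos (fun j _ => ha j) ⟨⟨0, hn⟩, Finset.mem_univ _⟩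
  have hpμ := isProbabilityMeasure_gammaPi ha
  have hn' : (0 : ℝ) < n := by exact_mod_cast hn
  set α := ∑ j, a j
  have hsin : 0 < Real.sin (2 * δ) :=
    Real.sin_pos_of_pos_of_lt_pi (by linarith) (by linarith [Real.pi_pos])
  obtain ⟨C, N, hC, hf⟩ := polyBoundedOn_raySolution hα
  have hpos : 0 < Real.sin (2 * δ) * κ ^ 2 / 2 := by positivity
  have hint := ((integrableOn_one_add_pow_mul_exp hpos N).const_mul
    ((n : ℝ)⁻¹ ^ (-α / 2) * (C * (1 + √n) ^ N) * (κ ^ (1 - α) * ‖cylinderIntegral α 0‖))).comp_fst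
    (gammaPi a)
  have mf := (continuous_raySolution hα).measurable
  have mk := (continuous_cylinderKernel hα).measurable
  have mv : Measurable (selfNormalizedSq : (Fin n → ℝ) → ℝ) := measurable_selfNormalizedSq
  have m1 : Measurable fun p : ℝ × (Fin n → ℝ) =>
      raySolution α (p.1 / √(selfNormalizedSq p.2)) := mf.comp (by fun_prop)
  have m2 : Measurable fun p : ℝ × (Fin n → ℝ) =>
      cylinderKernel α (κ * rayDir δ * p.1) := mk.comp (by fun_prop)
  refine hint.mono' (Measurable.aestronglyMeasurable (by fun_prop)) ?_
  have ae1 : ∀ᵐ p : ℝ × (Fin n → ℝ) ∂(volume.restrict (Ioi 0)).prod (gammaPi a), 0 < p.1 :=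
    Measure.quasiMeasurePreserving_fst.ae (ae_restrict_mem measurableSet_Ioi)
  have ae2 : ∀ᵐ p : ℝ × (Fin n → ℝ) ∂(volume.restrict (Ioi 0)).prod (gammaPi a),
      0 < ∑ j, p.2 j :=
    Measure.quasiMeasurePreserving_snd.ae (ae_sum_pos_gammaPi hn ha)
  filter_upwards [ae1, ae2] with p hp hS
  have hv := inv_card_le_selfNormalizedSq hn hS
  set v := selfNormalizedSq p.2
  have hni : 0 < (n : ℝ)⁻¹ := by positivity
  have hv0 : 0 < v := lt_of_lt_of_le hni hv
  have b1 := norm_kernel_ray_le hα h0.le h1 hκ.le le_rfl hp.le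
  have b2 := hf (p.1 / √v) (by positivity)
  have b3 : v ^ (-α / 2) ≤ (n : ℝ)⁻¹ ^ (-α / 2) :=
    Real.rpow_le_rpow_of_nonpos hni hv (by linarith)
  have b4 : 1 + p.1 / √v ≤ (1 + √n) * (1 + p.1) := by
    have h5 : (√v)⁻¹ ≤ √n := by
      rw [← Real.sqrt_inv]
      exact Real.sqrt_le_sqrt (inv_le_of_inv_le₀ hn' hv)
    rw [div_eq_mul_inv]
    nlinarith [mul_le_mul_of_nonneg_left h5 hp.le, Real.sqrt_nonneg (n : ℝ)]
  have b5 : C * (1 + p.1 / √v) ^ N ≤ C * (1 + √n) ^ N * (1 + p.1) ^ N := by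
    rw [mul_assoc, ← mul_pow]
    gcongr
  rw [norm_mul, norm_mul, norm_mul, Complex.norm_real, Complex.norm_real,
    Real.norm_of_nonneg (by positivity), Real.norm_of_nonneg (by positivity)]
  calc _ ≤ (n : ℝ)⁻¹ ^ (-α / 2) * (C * (1 + √n) ^ N * (1 + p.1) ^ N) *
        (κ ^ (1 - α) * (‖cylinderIntegral α 0‖ *
          Real.exp (-(Real.sin (2 * δ) * κ ^ 2 / 2) * p.1 ^ 2))) := by
        gcongr
        exact b2.trans b5
    _ = _ := by ring

lemma ae_selfNormalizedSq_pos (hn : 0 < n) (ha : ∀ j, 0 < a j) :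
    ∀ᵐ y ∂gammaPi a, (n : ℝ)⁻¹ ≤ selfNormalizedSq y ∧ 0 < selfNormalizedSq y := by
  filter_upwards [ae_sum_pos_gammaPi hn ha] with y hy
  have hn' : (0 : ℝ) < n := by exact_mod_cast hn
  have := inv_card_le_selfNormalizedSq hn hy
  exact ⟨this, lt_of_lt_of_le (by positivity) this⟩

lemma integrable_rayTransform_comp (hn : 0 < n) (ha : ∀ j, 0 < a j) {κ δ : ℝ}
    (hκ : 0 < κ) (h0 : 0 < δ) (h1 : δ ≤ Real.pi / 4) :
    Integrable (fun y => rayTransform (∑ j, a j) δ (κ * √(selfNormalizedSq y))) (gammaPi a) := by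
  have hpμ := isProbabilityMeasure_gammaPi ha
  refine (integrable_prod_raySolution_mul_kernel hn ha hκ h0 h1).integral_prod_right.congr ?_
  filter_upwards [ae_selfNormalizedSq_pos hn ha] with y hy
  exact integral_raySolution_comp_div hκ hy.2

lemma integral_rayProduct_mul_kernel_eq (hn : 0 < n) (ha : ∀ j, 0 < a j) {κ δ : ℝ}
    (hκ : 0 < κ) (h0 : 0 < δ) (h1 : δ ≤ Real.pi / 4) :
    ((κ ^ (1 - ∑ j, a j) : ℝ) : ℂ) * ∫ s in Ioi (0 : ℝ), rayProduct a s *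
        cylinderKernel (∑ j, a j) (κ * rayDir δ * s) =
      (∫ y, rayTransform (∑ j, a j) δ (κ * √(selfNormalizedSq y)) ∂gammaPi a) /
        Real.Gamma (∑ j, a j) := by
  have hpμ := isProbabilityMeasure_gammaPi ha
  have hint := integrable_prod_raySolution_mul_kernel hn ha hκ h0 h1
  have h2 : ∫ y, rayTransform (∑ j, a j) δ (κ * √(selfNormalizedSq y)) ∂gammaPi a =
      ∫ y, (∫ s in Ioi (0 : ℝ), ((selfNormalizedSq y ^ (-(∑ j, a j) / 2) : ℝ) : ℂ) *
        raySolution (∑ j, a j) (s / √(selfNormalizedSq y)) *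
        (((κ ^ (1 - ∑ j, a j) : ℝ) : ℂ) *
          cylinderKernel (∑ j, a j) (κ * rayDir δ * s))) ∂gammaPi a := by
    refine integral_congr_ae ?_
    filter_upwards [ae_selfNormalizedSq_pos hn ha] with y hy
    exact (integral_raySolution_comp_div hκ hy.2).symm
  rw [h2, ← integral_integral_swap (f := fun s y =>
    ((selfNormalizedSq y ^ (-(∑ j, a j) / 2) : ℝ) : ℂ) *
        raySolution (∑ j, a j) (s / √(selfNormalizedSq y)) *
        (((κ ^ (1 - ∑ j, a j) : ℝ) : ℂ) *
          cylinderKernel (∑ j, a j) (κ * rayDir δ * s))) hint, ← integral_const_mul,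
    ← integral_div]
  refine integral_congr_ae (ae_of_all _ fun s => ?_)
  simp only
  rw [integral_mul_const, rayProduct_eq hn ha, integral_div]
  ring

lemma tendsto_integral_re_rayTransform (hn : 2 ≤ n) (ha : ∀ j, 0 < a j) (hsum : 1 < ∑ j, a j)
    {x : ℝ} (hx : 0 < x) :
    Tendsto (fun δ => ∫ y, ((rayDir 0)⁻¹ *
        rayTransform (∑ j, a j) δ (x ^ (-(1 / 2) : ℝ) * √(selfNormalizedSq y))).re ∂gammaPi a)
      (𝓝[>] 0) (𝓝 ((cylinderIntegral (∑ j, a j) 0 * cylinderIntegral (∑ j, a j + 1) 0).re *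
        Real.pi * (gammaPi a).real {y | selfNormalizedSq y ≤ x})) := by
  have hpμ := isProbabilityMeasure_gammaPi ha
  have hn0 : 0 < n := by omega
  have hn' : (0 : ℝ) < n := by exact_mod_cast hn0
  set α := ∑ j, a j
  set κ : ℝ := x ^ (-(1 / 2) : ℝ) with hκdef
  have hκ : 0 < κ := by positivity
  set c := (cylinderIntegral α 0 * cylinderIntegral (α + 1) 0).re
  have hmS : MeasurableSet {y : Fin n → ℝ | selfNormalizedSq y ≤ x} :=
    measurableSet_le measurable_selfNormalizedSq measurable_const
  have hlim : c * Real.pi * (gammaPi a).real {y | selfNormalizedSq y ≤ x} =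
      ∫ y, c * (Real.pi * (Iio 1).indicator 1 (κ * √(selfNormalizedSq y))) ∂gammaPi a := by
    rw [← integral_indicator_one hmS, ← integral_const_mul]
    refine integral_congr_ae ?_
    filter_upwards [ae_selfNormalizedSq_pos hn0 ha, ae_selfNormalizedSq_ne hn ha x hx]
      with y hy hne
    rw [mul_assoc]
    congr 2
    -- The limit yields the strict inequality V < x; the absence of an atom at x makes it equivalent
    -- to V ≤ x almost surely.
    have hiff : κ * √(selfNormalizedSq y) < 1 ↔ selfNormalizedSq y ≤ x := by
      have e : κ = (√x)⁻¹ := by rw [hκdef, Real.rpow_neg hx.le, Real.sqrt_eq_rpow]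
      rw [e, inv_mul_lt_iff₀ (Real.sqrt_pos.2 hx), mul_one, Real.sqrt_lt_sqrt_iff hy.2.le]
      exact ⟨le_of_lt, fun h => lt_of_le_of_ne h hne⟩
    by_cases h : selfNormalizedSq y ≤ x
    · rw [indicator_of_mem (show y ∈ {y : Fin n → ℝ | selfNormalizedSq y ≤ x} from h),
        indicator_of_mem (show _ ∈ Iio (1 : ℝ) from hiff.2 h)]
      rfl
    · rw [indicator_of_notMem (show y ∉ {y : Fin n → ℝ | selfNormalizedSq y ≤ x} from h),
        indicator_of_notMem (show _ ∉ Iio (1 : ℝ) from fun h' => h (hiff.1 h'))]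
  rw [hlim]
  have hev : ∀ᶠ δ : ℝ in 𝓝[>] 0, δ ∈ Ioc 0 (Real.pi / 4) :=
    Ioc_mem_nhdsGT (by positivity)
  refine tendsto_integral_filter_of_dominated_convergence
    (fun _ => |c| * ((κ * √((n : ℝ)⁻¹)) ^ (1 - α) * Real.pi)) ?_ ?_ (integrable_const _) ?_
  · filter_upwards [hev] with δ hδ
    exact (((integrable_rayTransform_comp hn0 ha hκ hδ.1 hδ.2).const_mul _).re).aestronglyMeasurable
  · filter_upwards [hev] with δ hδ
    filter_upwards [ae_selfNormalizedSq_pos hn0 ha] with y hy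
    have hs : 0 < √(selfNormalizedSq y) := Real.sqrt_pos.2 hy.2
    refine (abs_re_rayTransform_le hsum hδ.1 hδ.2 (by positivity)).trans ?_
    gcongr ?_ * (?_ * ?_)
    exact Real.rpow_le_rpow_of_nonpos (by positivity)
      (by gcongr; exact hy.1) (by linarith)
  · filter_upwards [ae_selfNormalizedSq_pos hn0 ha, ae_selfNormalizedSq_ne hn ha x hx]
      with y hy hne
    have hs : 0 < √(selfNormalizedSq y) := Real.sqrt_pos.2 hy.2
    refine tendsto_re_rayTransform hsum (by positivity) fun h => hne ?_
    have e : κ = (√x)⁻¹ := by rw [hκdef, Real.rpow_neg hx.le, Real.sqrt_eq_rpow]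
    rw [e, inv_mul_eq_one₀ (Real.sqrt_pos.2 hx).ne', Real.sqrt_inj hx.le hy.2.le] at h
    exact h.symm

/-- Duplication formula again; the Γ(α) here cancels the one dividing the mixture formula. -/
lemma cylinderIntegral_zero_mul_add_one {α : ℝ} (hα : 0 < α) :
    (cylinderIntegral α 0 * cylinderIntegral (α + 1) 0).re = √Real.pi * Real.Gamma α / √2 := by
  rw [cylinderIntegral_zero hα, cylinderIntegral_zero (by linarith), ← Complex.ofReal_mul,
    Complex.ofReal_re]
  have h := Real.Gamma_mul_Gamma_add_half (α / 2)
  rw [show 2 * (α / 2) = α by ring, show α / 2 + 1 / 2 = (α + 1) / 2 by ring] at h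
  have e : (2 : ℝ) ^ (α / 2 - 1) * 2 ^ ((α + 1) / 2 - 1) * 2 ^ (1 - α) = (√2)⁻¹ := by
    rw [Real.sqrt_eq_rpow, ← Real.rpow_neg (by norm_num), ← Real.rpow_add (by norm_num),
      ← Real.rpow_add (by norm_num)]
    ring_nf
  calc _ = 2 ^ (α / 2 - 1) * 2 ^ ((α + 1) / 2 - 1) *
        (Real.Gamma (α / 2) * Real.Gamma ((α + 1) / 2)) := by ring
    _ = (2 ^ (α / 2 - 1) * 2 ^ ((α + 1) / 2 - 1) * 2 ^ (1 - α)) *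
        (Real.Gamma α * √Real.pi) := by rw [h]; ring
    _ = _ := by rw [e]; ring

/-- For δ > 0 the integral of the product against the rotated kernel equals an expectation of the
transform. The two sides converge as δ → 0 by separate dominations, and uniqueness of limits gives
the identity at δ = 0. -/
lemma re_integral_rayProduct_mul_kernel (hn : 2 ≤ n) (ha : ∀ j, 0 < a j) (hsum : 1 < ∑ j, a j)
    {x : ℝ} (hx : 0 < x) :
    x ^ ((∑ j, a j - 1) / 2) * ((rayDir 0)⁻¹ * ∫ s in Ioi (0 : ℝ), rayProduct a s *
        cylinderKernel (∑ j, a j) ((x ^ (-(1 / 2) : ℝ) : ℝ) * rayDir 0 * s)).re =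
      √Real.pi * Real.pi / √2 * (gammaPi a).real {y | selfNormalizedSq y ≤ x} := by
  have hn0 : 0 < n := by omega
  have hα : 0 < ∑ j, a j := by linarith
  have hκ : 0 < x ^ (-(1 / 2) : ℝ) := by positivity
  have hΓ := (Real.Gamma_pos_of_pos hα).ne'
  have e1 : x ^ ((∑ j, a j - 1) / 2) = (x ^ (-(1 / 2) : ℝ)) ^ (1 - ∑ j, a j) := by
    rw [← Real.rpow_mul hx.le]; ring_nf
  rw [e1]
  have L1 := ((Complex.continuous_re.tendsto _).comp
    ((tendsto_integral_rayProduct_mul_kernel hn ha hsum hκ).const_mul (rayDir 0)⁻¹)).const_mul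
      ((x ^ (-(1 / 2) : ℝ)) ^ (1 - ∑ j, a j))
  have L2 := (tendsto_integral_re_rayTransform hn ha hsum hx).div_const (Real.Gamma (∑ j, a j))
  rw [cylinderIntegral_zero_mul_add_one hα] at L2
  refine tendsto_nhds_unique (L1.congr' ?_) (L2.trans_eq ?_)
  · filter_upwards [Ioc_mem_nhdsGT (show (0 : ℝ) < Real.pi / 4 by positivity)] with δ hδ
    have h := integral_rayProduct_mul_kernel_eq hn0 ha hκ hδ.1 hδ.2
    have hint := (integrable_rayTransform_comp hn0 ha hκ hδ.1 hδ.2).const_mul (rayDir 0)⁻¹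
    have hre : ∫ y, ((rayDir 0)⁻¹ *
        rayTransform (∑ j, a j) δ (x ^ (-(1 / 2) : ℝ) * √(selfNormalizedSq y))).re ∂gammaPi a =
        (∫ y, (rayDir 0)⁻¹ *
        rayTransform (∑ j, a j) δ (x ^ (-(1 / 2) : ℝ) * √(selfNormalizedSq y)) ∂gammaPi a).re :=
      integral_re hint
    rw [hre, integral_const_mul, Function.comp_apply, ← Complex.re_ofReal_mul, mul_left_comm, h,
      ← mul_div_assoc, Complex.div_ofReal_re]
  · congr 1
    field_simp

lemma principalSqrt_neg_I : principalSqrt (-Complex.I) = rayDir 0 := by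
  rw [principalSqrt, Complex.cpow_def_of_ne_zero (neg_ne_zero.2 Complex.I_ne_zero),
    Complex.log_neg_I, rayDir]
  congr 1
  push_cast
  ring

lemma principalSqrt_I : principalSqrt Complex.I = (rayDir 0)⁻¹ := by
  rw [principalSqrt, Complex.cpow_def_of_ne_zero Complex.I_ne_zero, Complex.log_I, rayDir,
    ← Complex.exp_neg]
  congr 1
  push_cast
  ring

lemma I_mul_principalSqrt_I : Complex.I * principalSqrt Complex.I = -rayDir 0 := by
  have hζ : rayDir 0 ≠ 0 := Complex.exp_ne_zero _
  rw [principalSqrt_I, mul_inv_eq_iff_eq_mul₀ hζ]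
  linear_combination rayDir_zero_sq

/-- Since ζ² = -i, the factor exp(-is²/4) cancels the exp(-z²/4) of each D_{-a_j}, while
exp(is²/(4x)) doubles that of D_{-α} into the exp(-w²/2) of the kernel. -/
lemma cylinderIntegrand_eq (ha : ∀ j, 0 < a j) (hsum : 1 < ∑ j, a j) {x : ℝ} (hx : 0 < x)
    (s : ℝ) :
    cylinderIntegrand a x s = (rayDir 0)⁻¹ * (rayProduct a s * cylinderKernel (∑ j, a j)
      ((x ^ (-(1 / 2) : ℝ) : ℝ) * rayDir 0 * s)) / Real.Gamma (∑ j, a j) := by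
  have hz := rayDir_zero_sq
  have hα : 0 < ∑ j, a j := by linarith
  set κ : ℝ := x ^ (-(1 / 2) : ℝ) with hκ
  have hκ2 : (κ : ℂ) ^ 2 = (x : ℂ)⁻¹ := by
    have : κ ^ 2 = x⁻¹ := by
      rw [hκ, ← Real.rpow_natCast, ← Real.rpow_mul hx.le, ← Real.rpow_neg_one]
      norm_num
    exact_mod_cast this
  have h1 (j : Fin n) : Complex.exp (-(Complex.I * (s : ℂ) ^ 2) / 4) *
      parabolicCylinderD (-a j) (Complex.I * principalSqrt Complex.I * (s : ℂ)) =
      raySolution (a j) s / Real.Gamma (a j) := by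
    rw [I_mul_principalSqrt_I, parabolicCylinderD_neg (ha j), ← mul_assoc, ← Complex.exp_add]
    have : -(Complex.I * (s : ℂ) ^ 2) / 4 + -(-rayDir 0 * s) ^ 2 / 4 = 0 := by
      linear_combination -(s : ℂ) ^ 2 / 4 * hz
    rw [this, Complex.exp_zero, one_mul, raySolution]
  have h2 : Complex.exp (Complex.I * (s : ℂ) ^ 2 / (4 * (x : ℂ))) *
      parabolicCylinderD (-∑ j, a j) (principalSqrt (-Complex.I) * (s : ℂ) * (κ : ℂ)) =
      cylinderKernel (∑ j, a j) (κ * rayDir 0 * s) / Real.Gamma (∑ j, a j) := by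
    rw [principalSqrt_neg_I, parabolicCylinderD_neg hα, ← mul_assoc, ← Complex.exp_add,
      show rayDir 0 * (s : ℂ) * (κ : ℂ) = κ * rayDir 0 * s by ring, cylinderKernel]
    have : Complex.I * (s : ℂ) ^ 2 / (4 * (x : ℂ)) + -(κ * rayDir 0 * s) ^ 2 / 4 =
        -(κ * rayDir 0 * s) ^ 2 / 2 := by
      rw [show Complex.I * (s : ℂ) ^ 2 / (4 * (x : ℂ)) =
        Complex.I * (s : ℂ) ^ 2 / 4 * (x : ℂ)⁻¹ by field_simp, ← hκ2]
      linear_combination (κ : ℂ) ^ 2 * (s : ℂ) ^ 2 / 4 * hz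
    rw [this, mul_div_assoc]
  rw [cylinderIntegrand, Finset.prod_congr rfl fun j _ => h1 j, mul_assoc (∏ j, _), ← hκ, h2,
    principalSqrt_I, rayProduct]
  ring

end Assembly

theorem theorem2 {Ω : Type*} [MeasurableSpace Ω] (P : Measure Ω) [IsProbabilityMeasure P]
    (n : ℕ) (hn : 2 ≤ n) (a : Fin n → ℝ) (ha : ∀ j, 0 < a j) (hsum : 1 < ∑ j, a j)
    (X : Fin n → Ω → ℝ) (hindep : iIndepFun X P)
    (hlaw : ∀ j, HasLaw (X j) (gammaMeasure (a j) 1) P)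
    (x : ℝ) (hx : 0 < x) :
    IntegrableOn (fun s : ℝ => cylinderIntegrand a x s) (Set.Ioi 0) ∧
      P.real {ω | (∑ j, X j ω ^ 2) / (∑ j, X j ω) ^ 2 ≤ x} =
        Real.pi ^ (-(3 / 2) : ℝ) * √2 * Real.Gamma (∑ j, a j) *
            x ^ (((∑ j, a j) - 1) / 2) *
          ∫ s in Set.Ioi (0 : ℝ), (cylinderIntegrand a x s).re := by
  have hα : 0 < ∑ j, a j := by linarith
  have hΓ := (Real.Gamma_pos_of_pos hα).ne'
  have hκ : 0 < x ^ (-(1 / 2) : ℝ) := by positivity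
  have hint : IntegrableOn (fun s : ℝ => cylinderIntegrand a x s) (Set.Ioi 0) := by
    simp_rw [cylinderIntegrand_eq ha hsum hx]
    exact ((integrableOn_rayProduct_mul_kernel hn ha hsum hκ le_rfl
      (by positivity)).const_mul _).div_const _
  refine ⟨hint, ?_⟩
  have hX : HasLaw (fun ω j => X j ω) (gammaPi a) P := hindep.hasLaw_pi hlaw
  have hP : P.real {ω | (∑ j, X j ω ^ 2) / (∑ j, X j ω) ^ 2 ≤ x} =
      (gammaPi a).real {y | selfNormalizedSq y ≤ x} :=
    hX.measureReal_eq (p := fun y => selfNormalizedSq y ≤ x)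
      (measurableSet_le measurable_selfNormalizedSq measurable_const)
  have hre : ∫ s in Set.Ioi (0 : ℝ), (cylinderIntegrand a x s).re =
      (∫ s in Set.Ioi (0 : ℝ), cylinderIntegrand a x s).re := integral_re hint
  rw [hP, hre]
  simp_rw [cylinderIntegrand_eq ha hsum hx]
  rw [integral_div, integral_const_mul, Complex.div_ofReal_re]
  have key := re_integral_rayProduct_mul_kernel hn ha hsum hx
  have hπ : Real.pi ^ (-(3 / 2) : ℝ) * (√Real.pi * Real.pi) = 1 := by
    rw [Real.sqrt_eq_rpow, ← Real.rpow_add_one Real.pi_pos.ne', ← Real.rpow_add Real.pi_pos]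
    norm_num
  have h2 : √2 ≠ 0 := by positivity
  generalize (Complex.re _) = R at key ⊢
  calc _ = (Real.pi ^ (-(3 / 2) : ℝ) * (√Real.pi * Real.pi)) *
        (gammaPi a).real {y | selfNormalizedSq y ≤ x} := by rw [hπ, one_mul]
    _ = Real.pi ^ (-(3 / 2) : ℝ) * √2 * (√Real.pi * Real.pi / √2 *
        (gammaPi a).real {y | selfNormalizedSq y ≤ x}) := by field_simp
    _ = _ := by rw [← key]; field_simp
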